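/- Let $\ell$ be an odd prime, let $b\ge 1$ and $r\ge 1$ be integers, and let $Q\in \mathrm{GL}_b(\mathbb Z_\ell)$ satisfy $Q\equiv I \pmod \ell$ and have no nonzero fixed vector in $\mathbb Z_\ell^b$. Let $F$ be an $r\times r$ matrix with entries in $\Lambda=\mathbb Z_\ell[[T_1,\dots,T_b]]$. For each $n\ge 0$ fix a primitive $\ell^n$-th root of unity $\zeta_{\ell^n}\in\mathbb C_\ell$, and for $v\in(\mathbb Z/\ell^n\mathbb Z)^b$ write $F(\zeta_{\ell^n}^{v})$ for the matrix obtained by evaluating $F$ at $T_i=\zeta_{\ell^n}^{v_i}-1$ ($1\le i\le b$). A vector is called primitive if at least one of its coordinates is a unit. Let $k_n(v)$ be the least positive integer with $Q^{k_n(v)}v\equiv v\pmod{\ell^n}$, and let $k_n$ be the minimum of $k_n(v)$ over all primitive $v\in\mathbb Z_\ell^b$. Put $$A_n(v)=F(\zeta_{\ell^n}^{Q^{-1}v})\,F(\zeta_{\ell^n}^{Q^{-2}v})\cdots F(\zeta_{\ell^n}^{Q^{-k_n(v)}v}),\qquad p_{n,v}(y)=\det(I-yA_n(v)),$$ $$r_n(y)=\prod_{v}p_{n,v}\bigl(y^{k_n(v)/k_n}\bigr),$$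 where $v$ runs over a set of representatives of the orbits of $Q^{\mathbb Z}$ on the primitive vectors of $(\mathbb Z/\ell^n\mathbb Z)^b$. Then, for every choice of the roots of unity and of the representatives, $r_n(y)\in\mathbb Z_\ell[y]$ for all $n$. There is an integer $n_0\ge 0$ such that $k_n=\ell^{\,n-n_0}$ for $n\ge n_0$ and $k_n=1$ for $n<n_0$ (so $k_{n+1}=\ell k_n$ for all $n\ge n_0$), and for every $n\ge n_0$ $$r_{n+1}(y)\equiv r_n(y)^{\ell^{b-1}}\pmod{\ell^{n}}\quad\text{in }\mathbb Z_\ell[y].$$ If moreover $Q=qI$ is a scalar matrix, then for every $n\ge n_0$ $$r_{n+1}(y)\equiv r_n(y)^{\ell^{b-1}}\pmod{\ell^{nb}}\quad\text{in }\mathbb Z_\ell[y].$$ -/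

import Mathlib

open scoped Polynomial

noncomputable section

namespace SkewIwasawa

variable {ℓ : ℕ} [Fact ℓ.Prime] {b r : ℕ}

/-- The inclusion `ℤ_ℓ → ℂ_ℓ`. -/
def ofPadicInt (ℓ : ℕ) [Fact ℓ.Prime] : ℤ_[ℓ] →+* ℂ_[ℓ] :=
  (algebraMap ℚ_[ℓ] ℂ_[ℓ]).comp (algebraMap ℤ_[ℓ] ℚ_[ℓ])

/-- The value at `T = x` of a power series `f ∈ ℤ_ℓ⟦T_1, …, T_b⟧`; the series converges
in `ℂ_ℓ` as soon as `‖x i‖ < 1` for every `i`. -/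
def evalSeries (f : MvPowerSeries (Fin b) ℤ_[ℓ]) (x : Fin b → ℂ_[ℓ]) : ℂ_[ℓ] :=
  ∑' m : Fin b →₀ ℕ, ofPadicInt ℓ (MvPowerSeries.coeff m f) * ∏ i, x i ^ m i

/-- The matrix `F(ζ^v)`: the matrix of power series `F` evaluated at `T_i = ζ^{v_i} - 1`, that is at
`t_i = 1 + T_i = ζ^{v_i}`, where `ζ` is an `ℓ^n`-th root of unity and `v` is a vector
mod `ℓ^n`. -/
def evalAtRoot (F : Matrix (Fin r) (Fin r) (MvPowerSeries (Fin b) ℤ_[ℓ])) {n : ℕ} (ζ : ℂ_[ℓ])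
    (v : Fin b → ZMod (ℓ ^ n)) : Matrix (Fin r) (Fin r) ℂ_[ℓ] :=
  F.map fun f => evalSeries f fun i => ζ ^ (v i).val - 1

/-- The action of the integer power `Q ^ m` on vectors mod `ℓ^n`. -/
def act (Q : GL (Fin b) ℤ_[ℓ]) {n : ℕ} (m : ℤ) (v : Fin b → ZMod (ℓ ^ n)) :
    Fin b → ZMod (ℓ ^ n) :=
  Matrix.mulVec (((Q ^ m : GL (Fin b) ℤ_[ℓ]) : Matrix (Fin b) (Fin b) ℤ_[ℓ]).map
    (PadicInt.toZModPow n)) v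

/-- A vector is primitive if at least one of its coordinates is a unit. -/
def IsPrimitive {R : Type*} [CommRing R] (v : Fin b → R) : Prop :=
  ∃ i, IsUnit (v i)

/-- `k_n(v)`: the least positive `k` with `Q^k v = v` mod `ℓ^n`. -/
def orbitSize (Q : GL (Fin b) ℤ_[ℓ]) {n : ℕ} (v : Fin b → ZMod (ℓ ^ n)) : ℕ :=
  sInf {k : ℕ | 0 < k ∧ act Q k v = v}

/-- `k_n`: the minimum of `k_n(v)` over the primitive vectors `v ∈ ℤ_ℓ^b`. -/
def minOrbitSize (Q : GL (Fin b) ℤ_[ℓ]) (n : ℕ) : ℕ :=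
  sInf {k : ℕ | ∃ v : Fin b → ℤ_[ℓ], IsPrimitive v ∧
    k = orbitSize Q (n := n) fun i => PadicInt.toZModPow n (v i)}

/-- `A_n(v) = F(ζ^{Q^{-1} v}) F(ζ^{Q^{-2} v}) ⋯ F(ζ^{Q^{-k_n(v)} v})`, the factors being multiplied
in this order. -/
def matA (Q : GL (Fin b) ℤ_[ℓ]) (F : Matrix (Fin r) (Fin r) (MvPowerSeries (Fin b) ℤ_[ℓ]))
    {n : ℕ} (ζ : ℂ_[ℓ]) (v : Fin b → ZMod (ℓ ^ n)) : Matrix (Fin r) (Fin r) ℂ_[ℓ] :=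
  ((List.range (orbitSize Q v)).map fun i => evalAtRoot F ζ (act Q (-((i : ℤ) + 1)) v)).prod

/-- `p_{n,v}(y) = det(I - y A_n(v))`. -/
def polyP (Q : GL (Fin b) ℤ_[ℓ]) (F : Matrix (Fin r) (Fin r) (MvPowerSeries (Fin b) ℤ_[ℓ]))
    {n : ℕ} (ζ : ℂ_[ℓ]) (v : Fin b → ZMod (ℓ ^ n)) : ℂ_[ℓ][X] :=
  (1 - (Polynomial.X : ℂ_[ℓ][X]) • (matA Q F ζ v).map Polynomial.C).det

/-- `S` is a set of representatives for the orbits of `Q^ℤ` on the primitive vectors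
mod `ℓ^n`. -/
def IsOrbitReps (Q : GL (Fin b) ℤ_[ℓ]) {n : ℕ} (S : Finset (Fin b → ZMod (ℓ ^ n))) : Prop :=
  (∀ v ∈ S, IsPrimitive v) ∧
    ∀ w : Fin b → ZMod (ℓ ^ n), IsPrimitive w → ∃! v, v ∈ S ∧ ∃ m : ℤ, act Q m v = w

/-- `r_n(y) = ∏_v p_{n,v}(y^{k_n(v)/k_n})`, the product being over the given set of orbit
representatives. -/
def polyR (Q : GL (Fin b) ℤ_[ℓ]) (F : Matrix (Fin r) (Fin r) (MvPowerSeries (Fin b) ℤ_[ℓ]))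
    {n : ℕ} (ζ : ℂ_[ℓ]) (S : Finset (Fin b → ZMod (ℓ ^ n))) : ℂ_[ℓ][X] :=
  ∏ v ∈ S, (polyP Q F ζ v).comp (Polynomial.X ^ (orbitSize Q v / minOrbitSize Q n))

end SkewIwasawa

end

open scoped Polynomial

noncomputable section

namespace SkewIwasawa

theorem derivation_prod {R A ι : Type*} [CommRing R] [CommRing A] [Algebra R A]
    [DecidableEq ι] (D : Derivation R A A) (s : Finset ι) (f : ι → A) :
    D (∏ i ∈ s, f i) = ∑ i ∈ s, (∏ j ∈ s.erase i, f j) * D (f i) := by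
  induction s using Finset.induction_on with
  | empty => simp
  | insert a s ha ih =>
    rw [Finset.prod_insert ha, Finset.sum_insert ha, Finset.erase_insert ha, D.leibniz, ih,
      smul_eq_mul, smul_eq_mul, Finset.mul_sum, add_comm]
    congr 1
    refine Finset.sum_congr rfl fun i hi => ?_
    rw [Finset.erase_insert_of_ne (by rintro rfl; exact ha hi),
      Finset.prod_insert (fun h => ha (Finset.mem_of_mem_erase h)), mul_assoc]

/-- Jacobi's formula for a derivation. -/
theorem derivation_det {R A ι : Type*} [CommRing R] [CommRing A] [Algebra R A] [Fintype ι]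
    [DecidableEq ι] (D : Derivation R A A) (N : Matrix ι ι A) :
    D N.det = (N.adjugate * N.map D).trace := by
  have h1 : ∀ i, (N.adjugate * N.map D) i i = (N.updateCol i fun k => D (N k i)).det := by
    intro i
    rw [← Matrix.cramer_apply, Matrix.cramer_eq_adjugate_mulVec]
    rfl
  simp only [Matrix.trace, Matrix.diag, h1, Matrix.det_apply, map_sum]
  rw [Finset.sum_comm]
  refine Finset.sum_congr rfl fun σ _ => ?_
  rw [Units.smul_def, map_zsmul, derivation_prod, Finset.smul_sum]
  refine Finset.sum_congr rfl fun i _ => ?_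
  rw [Units.smul_def]
  congr 1
  rw [← Finset.mul_prod_erase _ _ (Finset.mem_univ i), Matrix.updateCol_self, mul_comm]
  congr 1
  refine Finset.prod_congr rfl fun j hj => ?_
  rw [Matrix.updateCol_ne (Finset.ne_of_mem_erase hj)]

/-- `R` has constant coefficient `1` and logarithmic derivative `-∑ t_j y^(j-1)`. -/
def HasLogDeriv {A : Type*} [CommRing A] (R : PowerSeries A) (t : ℕ → A) : Prop :=
  PowerSeries.constantCoeff R = 1 ∧
    PowerSeries.derivative A R = -(R * PowerSeries.mk fun j => t (j + 1))

namespace HasLogDeriv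

variable {A : Type*} [CommRing A]

theorem one : HasLogDeriv (1 : PowerSeries A) 0 := by
  refine ⟨by simp, ?_⟩
  ext n
  simp

theorem mul {R₁ R₂ : PowerSeries A} {t₁ t₂ : ℕ → A} (h₁ : HasLogDeriv R₁ t₁)
    (h₂ : HasLogDeriv R₂ t₂) : HasLogDeriv (R₁ * R₂) (t₁ + t₂) := by
  refine ⟨by simp [h₁.1, h₂.1], ?_⟩
  have : (PowerSeries.mk fun j => (t₁ + t₂) (j + 1)) =
      (PowerSeries.mk fun j => t₁ (j + 1)) + PowerSeries.mk fun j => t₂ (j + 1) := by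
    ext; simp
  rw [Derivation.leibniz, h₁.2, h₂.2, this, smul_eq_mul, smul_eq_mul]
  ring

theorem prod {ι : Type*} (s : Finset ι) {R : ι → PowerSeries A} {t : ι → ℕ → A}
    (h : ∀ i ∈ s, HasLogDeriv (R i) (t i)) : HasLogDeriv (∏ i ∈ s, R i) (∑ i ∈ s, t i) := by
  classical
  induction s using Finset.induction_on with
  | empty => simpa using one
  | insert a s ha ih =>
    rw [Finset.prod_insert ha, Finset.sum_insert ha]
    exact (h a (Finset.mem_insert_self a s)).mul
      (ih fun i hi => h i (Finset.mem_insert_of_mem hi))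

theorem pow {R : PowerSeries A} {t : ℕ → A} (h : HasLogDeriv R t) (k : ℕ) :
    HasLogDeriv (R ^ k) (k • t) := by
  simpa using prod (Finset.range k) (fun _ _ => h)

theorem congr {R : PowerSeries A} {t t' : ℕ → A} (h : HasLogDeriv R t)
    (htt : ∀ j, 0 < j → t j = t' j) : HasLogDeriv R t' := by
  refine ⟨h.1, ?_⟩
  rw [h.2]
  congr 3
  ext j
  exact htt _ j.succ_pos

theorem map {B : Type*} [CommRing B] (f : A →+* B) (hf : Function.Injective f)
    {R : PowerSeries A} {t : ℕ → A} :
    HasLogDeriv (R.map f) (fun j => f (t j)) ↔ HasLogDeriv R t := by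
  have h1 : PowerSeries.derivative B (R.map f) = (PowerSeries.derivative A R).map f := by
    ext n
    simp [PowerSeries.coeff_derivative]
  have h2 : -(R.map f * PowerSeries.mk fun j => f (t (j + 1))) =
      (-(R * PowerSeries.mk fun j => t (j + 1))).map f := by
    rw [map_neg, map_mul]
    rw [show (PowerSeries.mk fun j => f (t (j + 1))) =
      (PowerSeries.mk fun j => t (j + 1)).map f by ext; simp]
  have hinj : Function.Injective (PowerSeries.map f) := PowerSeries.map_injective f hf
  unfold HasLogDeriv
  rw [h1, h2, hinj.eq_iff]
  refine and_congr ?_ Iff.rfl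
  rw [← PowerSeries.coeff_zero_eq_constantCoeff_apply,
    ← PowerSeries.coeff_zero_eq_constantCoeff_apply, PowerSeries.coeff_map, ← f.map_one,
    hf.eq_iff]

/-- The recursion satisfied by the coefficients. -/
theorem coeff_succ {R : PowerSeries A} {t : ℕ → A} (h : HasLogDeriv R t) (n : ℕ) :
    PowerSeries.coeff (n + 1) R * (n + 1 : ℕ) =
      -∑ p ∈ Finset.HasAntidiagonal.antidiagonal n, PowerSeries.coeff p.1 R * t (p.2 + 1) := by
  have := congrArg (PowerSeries.coeff n) h.2
  rw [PowerSeries.coeff_derivative, map_neg, PowerSeries.coeff_mul] at this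
  simpa using this

end HasLogDeriv

theorem hasLogDeriv_det {A ι : Type*} [CommRing A] [Fintype ι] [DecidableEq ι]
    (M : Matrix ι ι A) {k : ℕ} (hk : 0 < k) :
    HasLogDeriv ((1 : Matrix ι ι (PowerSeries A)) -
        (PowerSeries.X ^ k : PowerSeries A) • M.map (PowerSeries.C (R := A))).det
      (fun j => if k ∣ j then k * (M ^ (j / k)).trace else 0) := by
  set N : Matrix ι ι (PowerSeries A) := 1 - (PowerSeries.X ^ k : PowerSeries A) •
    M.map (PowerSeries.C (R := A)) with hN
  set E : Matrix ι ι (PowerSeries A) := Matrix.of fun p q => PowerSeries.mk fun j =>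
    if k ∣ j then (M ^ (j / k)) p q else 0 with hE
  have hNE : N * E = 1 := by
    rw [hN, sub_mul, one_mul, Matrix.smul_mul, sub_eq_iff_eq_add]
    ext p q j
    rw [Matrix.add_apply, Matrix.smul_apply, smul_eq_mul, map_add, PowerSeries.coeff_X_pow_mul',
      Matrix.one_apply, hE, Matrix.of_apply, PowerSeries.coeff_mk]
    rcases lt_or_ge j k with hj | hj
    · rw [if_neg (not_le.2 hj), add_zero]
      rcases Nat.eq_zero_or_pos j with rfl | hj0
      · by_cases hpq : p = q <;> simp [hpq]
      · rw [if_neg (Nat.not_dvd_of_pos_of_lt hj0 hj)]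
        by_cases hpq : p = q <;> simp [hpq, PowerSeries.coeff_one, hj0.ne']
    · rw [if_pos hj, Matrix.mul_apply, map_sum]
      have h0 : PowerSeries.coeff j (if p = q then (1 : PowerSeries A) else 0) = 0 := by
        by_cases hpq : p = q <;> simp [hpq, PowerSeries.coeff_one, (hk.trans_le hj).ne']
      obtain ⟨i, rfl⟩ := Nat.exists_eq_add_of_le hj
      rw [h0, zero_add]
      simp only [Matrix.map_apply, PowerSeries.coeff_C_mul, Matrix.of_apply,
        PowerSeries.coeff_mk, Nat.add_sub_cancel_left]
      by_cases hki : k ∣ i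
      · simp only [hki, Nat.dvd_add_right (dvd_refl k), if_true, Nat.add_div_left i hk, pow_succ',
          Matrix.mul_apply]
      · simp [hki, Nat.dvd_add_right (dvd_refl k)]
  have hadj : N.adjugate = N.det • E := by
    calc N.adjugate = N.adjugate * (N * E) := by rw [hNE, mul_one]
      _ = N.det • E := by rw [← mul_assoc, Matrix.adjugate_mul, Matrix.smul_mul, one_mul]
  constructor
  · rw [RingHom.map_det]
    have : (PowerSeries.constantCoeff (R := A)).mapMatrix N = 1 := by
      ext p q
      by_cases hpq : p = q <;>
        simp [hN, Matrix.one_apply, hpq, hk.ne', RingHom.mapMatrix_apply]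
    rw [this, Matrix.det_one]
  · rw [derivation_det, hadj, Matrix.smul_mul, Matrix.trace_smul, smul_eq_mul, ← mul_neg]
    congr 1
    ext j
    have hD : N.map (⇑(PowerSeries.derivative A)) =
        -(((k : PowerSeries A) * PowerSeries.X ^ (k - 1)) • M.map (PowerSeries.C (R := A))) := by
      ext1 p q
      rw [Matrix.map_apply, hN, Matrix.sub_apply, map_sub]
      have : PowerSeries.derivative A ((1 : Matrix ι ι (PowerSeries A)) p q) = 0 := by
        by_cases hpq : p = q <;> simp [Matrix.one_apply, hpq]
      rw [this, Matrix.smul_apply, Matrix.map_apply, smul_eq_mul, Derivation.leibniz,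
        PowerSeries.derivative_C, Derivation.leibniz_pow, PowerSeries.derivative_X]
      simp only [Matrix.neg_apply, Matrix.smul_apply, Matrix.map_apply, smul_eq_mul, nsmul_eq_mul]
      ring
    rw [hD, mul_neg, Matrix.trace_neg, map_neg, map_neg, Matrix.mul_smul, Matrix.trace_smul,
      smul_eq_mul, mul_assoc, ← nsmul_eq_mul, map_nsmul, PowerSeries.coeff_X_pow_mul',
      PowerSeries.coeff_mk]
    congr 1
    by_cases hj : k - 1 ≤ j
    · obtain ⟨i, rfl⟩ := Nat.exists_eq_add_of_le hj
      rw [if_pos hj, show k - 1 + i + 1 = k + i by omega, Nat.add_sub_cancel_left]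
      simp only [Matrix.trace, Matrix.diag, Matrix.mul_apply, map_sum, hE, Matrix.of_apply,
        Matrix.map_apply, PowerSeries.coeff_mul_C, PowerSeries.coeff_mk]
      by_cases hki : k ∣ i
      · simp only [hki, Nat.dvd_add_right (dvd_refl k), if_true, Nat.add_div_left i hk, pow_succ,
          Matrix.mul_apply, nsmul_eq_mul]
      · simp [hki, Nat.dvd_add_right (dvd_refl k)]
    · beta_reduce
      rw [if_neg hj, if_neg (Nat.not_dvd_of_pos_of_lt j.succ_pos (by omega)), smul_zero]

theorem HasLogDeriv.of_mul {A : Type*} [CommRing A] {R₁ R₂ : PowerSeries A} {t t₁ : ℕ → A}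
    (h : HasLogDeriv (R₁ * R₂) t) (h₁ : HasLogDeriv R₁ t₁) : HasLogDeriv R₂ (t - t₁) := by
  have hu : IsUnit R₁ := by
    rw [PowerSeries.isUnit_iff_constantCoeff, h₁.1]
    exact isUnit_one
  refine ⟨by simpa [h₁.1] using h.1, ?_⟩
  have : (PowerSeries.mk fun j => (t - t₁) (j + 1)) =
      (PowerSeries.mk fun j => t (j + 1)) - PowerSeries.mk fun j => t₁ (j + 1) := by
    ext; simp
  have h2 := h.2
  rw [Derivation.leibniz, h₁.2, smul_eq_mul, smul_eq_mul] at h2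
  apply hu.mul_left_cancel
  rw [this]
  linear_combination h2

theorem hasLogDeriv_one_add_mul_X_pow {A : Type*} [CommRing A] (c : A) {k : ℕ} (hk : 0 < k) :
    HasLogDeriv (1 + PowerSeries.C c * PowerSeries.X ^ k)
      (fun j => if k ∣ j then k * (-c) ^ (j / k) else 0) := by
  have := hasLogDeriv_det (Matrix.of fun _ _ : Fin 1 => -c) hk
  have hpow : ∀ i, ((Matrix.of fun _ _ : Fin 1 => -c) ^ i).trace = (-c) ^ i := by
    intro i
    induction i with
    | zero => simp
    | succ i ih => simp_all [pow_succ, Matrix.trace, Matrix.mul_apply]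
  simp only [hpow] at this
  convert this using 1
  simp [mul_comm]

theorem natCast_dvd_pow_pred (ℓ : ℕ) [Fact ℓ.Prime] {k : ℕ} (hk : 0 < k) :
    (k : ℤ_[ℓ]) ∣ (ℓ : ℤ_[ℓ]) ^ (k - 1) := by
  obtain ⟨v, m, hm, rfl⟩ := Nat.exists_eq_pow_mul_and_not_dvd hk.ne' ℓ (Fact.out : ℓ.Prime).ne_one
  have hu : IsUnit (m : ℤ_[ℓ]) := by
    rw [PadicInt.isUnit_iff, PadicInt.norm_natCast_eq_one_iff]
    exact ((Fact.out : ℓ.Prime).coprime_iff_not_dvd).2 hm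
  rw [Nat.cast_mul, hu.mul_right_dvd, Nat.cast_pow]
  refine pow_dvd_pow _ (Nat.le_sub_one_of_lt ?_)
  calc v < ℓ ^ v := Nat.lt_pow_self (Fact.out : ℓ.Prime).one_lt
    _ ≤ ℓ ^ v * m := Nat.le_mul_of_pos_right _ (Nat.pos_of_ne_zero fun h => hm (h ▸ dvd_zero ℓ))

/-- A Dwork-type lemma: divisibility of the logarithmic derivative integrates to divisibility
of the coefficients. -/
theorem HasLogDeriv.pow_dvd_coeff {ℓ : ℕ} [Fact ℓ.Prime] {K : ℕ} (hK : 0 < K)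
    {g : PowerSeries ℤ_[ℓ]} {t : ℕ → ℤ_[ℓ]} (hg : HasLogDeriv g t)
    (ht : ∀ j, 0 < j → (ℓ : ℤ_[ℓ]) ^ K * (j : ℕ) ∣ t j) {i : ℕ} (hi : 0 < i) :
    (ℓ : ℤ_[ℓ]) ^ K ∣ PowerSeries.coeff i g := by
  suffices H : ∀ d J : ℕ, 0 < J → ∀ (g : PowerSeries ℤ_[ℓ]) (t : ℕ → ℤ_[ℓ]), HasLogDeriv g t →
      (∀ j, 0 < j → (ℓ : ℤ_[ℓ]) ^ K * (j : ℕ) ∣ t j) → (∀ i, 0 < i → i < J → PowerSeries.coeff i g = 0) →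
      ∀ i, 0 < i → i < J + d → (ℓ : ℤ_[ℓ]) ^ K ∣ PowerSeries.coeff i g from
    H i 1 one_pos g t hg ht (by omega) i hi (by omega)
  clear hg ht hi i g t
  intro d
  induction d with
  | zero =>
    intro J _ g t _ _ h0 i hi hiJ
    rw [h0 i hi hiJ]
    exact dvd_zero _
  | succ d ih =>
    intro J hJ g t hg ht h0 i hi hiJ
    obtain ⟨c, hc⟩ : ∃ c, c = PowerSeries.coeff J g := ⟨_, rfl⟩
    have hcdvd : (ℓ : ℤ_[ℓ]) ^ K ∣ c := by
      obtain ⟨n, rfl⟩ := Nat.exists_eq_succ_of_ne_zero hJ.ne'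
      have h := hg.coeff_succ n
      rw [Finset.sum_eq_single (0, n)] at h
      · rw [PowerSeries.coeff_zero_eq_constantCoeff_apply, hg.1, one_mul] at h
        have h2 : (ℓ : ℤ_[ℓ]) ^ K * ((n + 1 : ℕ) : ℤ_[ℓ]) ∣ c * ((n + 1 : ℕ) : ℤ_[ℓ]) := by
          rw [hc, Nat.succ_eq_add_one, h, dvd_neg]
          exact ht _ n.succ_pos
        exact (mul_dvd_mul_iff_right (by exact_mod_cast n.succ_ne_zero)).1 h2
      · rintro ⟨p, q⟩ hpq hne
        have hpq' : p + q = n := Finset.HasAntidiagonal.mem_antidiagonal.1 hpq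
        rw [h0 p (Nat.pos_of_ne_zero ?_) (by omega), zero_mul]
        rintro rfl
        exact hne (by simpa using hpq')
      · intro h
        exact absurd (Finset.HasAntidiagonal.mem_antidiagonal.2 (zero_add n)) h
    set u : PowerSeries ℤ_[ℓ] := 1 + PowerSeries.C c * PowerSeries.X ^ J with hu
    have hulog := hasLogDeriv_one_add_mul_X_pow c hJ
    rw [← hu] at hulog
    have huu : IsUnit u := by
      rw [PowerSeries.isUnit_iff_constantCoeff, hulog.1]
      exact isUnit_one
    obtain ⟨g', rfl⟩ : ∃ g', g = u * g' := huu.dvd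
    have hg' := hg.of_mul hulog
    have hcoeff : ∀ i, PowerSeries.coeff i (u * g') =
        PowerSeries.coeff i g' + c * if J ≤ i then PowerSeries.coeff (i - J) g' else 0 := by
      intro i
      rw [hu, add_mul, one_mul, map_add, mul_assoc, PowerSeries.coeff_C_mul,
        PowerSeries.coeff_X_pow_mul']
    have hstep := ih (J + 1) J.succ_pos g' _ hg' ?_ ?_
    · rw [hcoeff]
      exact dvd_add (hstep i hi (by omega)) (hcdvd.mul_right _)
    · intro j hj0
      refine dvd_sub (ht j hj0) ?_
      beta_reduce
      split_ifs with hj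
      · obtain ⟨k, rfl⟩ := hj
        rw [Nat.mul_div_cancel_left k hJ, Nat.cast_mul, mul_left_comm]
        refine mul_dvd_mul_left _ ?_
        have hk : 0 < k := Nat.pos_of_mul_pos_left hj0
        refine (mul_dvd_mul_left _ (natCast_dvd_pow_pred ℓ hk)).trans ?_
        rw [← pow_add]
        have hKk : K + (k - 1) ≤ K * k := by
          obtain ⟨K', rfl⟩ := Nat.exists_eq_succ_of_ne_zero hK.ne'
          obtain ⟨k', rfl⟩ := Nat.exists_eq_succ_of_ne_zero hk.ne'
          simp only [Nat.succ_eq_add_one, Nat.add_sub_cancel]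
          nlinarith [Nat.zero_le (K' * k')]
        refine (pow_dvd_pow _ hKk).trans ?_
        rw [pow_mul, neg_pow]
        exact (pow_dvd_pow_of_dvd hcdvd k).mul_left _
      · exact dvd_zero _
    · intro i hi hiJ
      have h := hcoeff i
      have hg0 : PowerSeries.coeff 0 g' = 1 := by
        rw [PowerSeries.coeff_zero_eq_constantCoeff_apply, hg'.1]
      rcases (Nat.lt_succ_iff.1 hiJ).lt_or_eq with h1 | rfl
      · rw [h0 i hi h1, if_neg (not_le.2 h1), mul_zero, add_zero] at h
        exact h.symm
      · rw [if_pos le_rfl, Nat.sub_self, hg0, mul_one, ← hc] at h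
        simpa using h

/-- Sum of an invariant function over a finite set, orbit by orbit. -/
theorem sum_eq_sum_minimalPeriod_mul {X A : Type*} [Fintype X] [DecidableEq X] [CommSemiring A]
    (π : Equiv.Perm X) (h : X → A) (hinv : ∀ x, h (π x) = h x) (S : Finset X)
    (hS : ∀ x, h x ≠ 0 → ∃! v, v ∈ S ∧ π.SameCycle v x) :
    ∑ x, h x = ∑ v ∈ S, (Function.minimalPeriod π v : A) * h v := by
  classical
  have hinvn : ∀ (i : ℕ) x, h ((π ^ i) x) = h x := by
    intro i x
    induction i with
    | zero => rfl
    | succ i ih => rw [pow_succ', Equiv.Perm.mul_apply, hinv, ih]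
  have hsame : ∀ v x, π.SameCycle v x → h x = h v := by
    intro v x hvx
    obtain ⟨i, _, rfl⟩ := hvx.exists_pow_eq'
    exact hinvn i v
  have h1 : ∀ x, h x = ∑ v ∈ S, if π.SameCycle v x then h x else 0 := by
    intro x
    by_cases hx : h x = 0
    · simp [hx]
    · obtain ⟨v, ⟨hvS, hvx⟩, huniq⟩ := hS x hx
      rw [Finset.sum_eq_single v, if_pos hvx]
      · intro w hw hwv
        exact if_neg fun hwx => hwv (huniq w ⟨hw, hwx⟩)
      · exact fun hv => absurd hvS hv
  rw [Finset.sum_congr rfl fun x _ => h1 x, Finset.sum_comm]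
  refine Finset.sum_congr rfl fun v _ => ?_
  have h2 : ∀ x, (if π.SameCycle v x then h x else 0) = if π.SameCycle v x then h v else 0 := by
    intro x
    split_ifs with hx
    · exact hsame v x hx
    · rfl
  rw [Finset.sum_congr rfl fun x _ => h2 x, ← Finset.sum_filter, Finset.sum_const, nsmul_eq_mul]
  congr 2
  have hper : 0 < Function.minimalPeriod π v := by
    rw [Function.minimalPeriod_pos_iff_mem_periodicPts]
    refine ⟨orderOf π, orderOf_pos π, ?_⟩
    rw [Function.IsPeriodicPt, Function.IsFixedPt, Equiv.Perm.iterate_eq_pow, pow_orderOf_eq_one]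
    rfl
  have himg : (Finset.univ.filter fun x => π.SameCycle v x) =
      (Finset.range (Function.minimalPeriod π v)).image fun i => π^[i] v := by
    ext x
    simp only [Finset.mem_filter, Finset.mem_univ, true_and, Finset.mem_image, Finset.mem_range]
    constructor
    · intro hx
      obtain ⟨i, _, rfl⟩ := hx.exists_pow_eq'
      refine ⟨i % Function.minimalPeriod π v, Nat.mod_lt _ hper, ?_⟩
      rw [Function.iterate_mod_minimalPeriod_eq, Equiv.Perm.iterate_eq_pow]
    · rintro ⟨i, _, rfl⟩
      rw [Equiv.Perm.iterate_eq_pow]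
      exact ⟨i, by simp⟩
  rw [himg, Finset.card_image_of_injOn, Finset.card_range]
  intro i hi j hj hij
  exact (Function.iterate_eq_iterate_iff_of_lt_minimalPeriod (by simpa using hi)
    (by simpa using hj)).1 hij

/-- Divisibility of the sum of an invariant function under a permutation of prime power order. -/
theorem pow_mul_dvd_sum_of_perm {X A : Type*} [Fintype X] [CommRing A] {ℓ : ℕ}
    (hℓ : ℓ.Prime) (τ : Equiv.Perm X) (N : ℕ) (hτ : τ ^ ℓ ^ N = 1) (h : X → A)
    (hinv : ∀ x, h (τ x) = h x) (D : A)
    (hdvd : ∀ x, ∀ e ≤ N, (τ ^ ℓ ^ e) x = x → (ℓ : A) ^ (N - e) * D ∣ h x) :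
    (ℓ : A) ^ N * D ∣ ∑ x, h x := by
  classical
  let s : Setoid X := Equiv.Perm.SameCycle.setoid τ
  rw [sum_eq_sum_minimalPeriod_mul τ h hinv (Finset.univ.image fun q : Quotient s => q.out)]
  · refine Finset.dvd_sum fun v _ => ?_
    have hp : Function.IsPeriodicPt τ (ℓ ^ N) v := by
      rw [Function.IsPeriodicPt, Function.IsFixedPt, Equiv.Perm.iterate_eq_pow, hτ]
      rfl
    obtain ⟨e, he, hee⟩ := (Nat.dvd_prime_pow hℓ).1 hp.minimalPeriod_dvd
    have := hdvd v e he (by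
      have := Function.isPeriodicPt_minimalPeriod τ v
      rwa [hee, Function.IsPeriodicPt, Function.IsFixedPt, Equiv.Perm.iterate_eq_pow] at this)
    obtain ⟨N', rfl⟩ := Nat.exists_eq_add_of_le he
    rw [hee, Nat.cast_pow, pow_add, mul_assoc]
    rw [Nat.add_sub_cancel_left] at this
    exact mul_dvd_mul_left _ this
  · intro x _
    refine ⟨(Quotient.mk s x).out, ⟨Finset.mem_image_of_mem _ (Finset.mem_univ _),
      Quotient.mk_out (s := s) x⟩, ?_⟩
    rintro w ⟨hw, hwx⟩
    obtain ⟨q, _, rfl⟩ := Finset.mem_image.1 hw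
    congr 1
    rw [← q.out_eq]
    exact Quotient.sound hwx

theorem list_prod_matrix_apply {A ι : Type*} [CommSemiring A] [Fintype ι] [DecidableEq ι]
    (M : ℕ → Matrix ι ι A) (m : ℕ) (p q : ι) :
    ((List.range (m + 1)).map M).prod p q = ∑ a : Fin m → ι, ∏ i : Fin (m + 1),
      M i ((Fin.cons p a : Fin (m + 1) → ι) i) ((Fin.snoc a q : Fin (m + 1) → ι) i) := by
  induction m generalizing q with
  | zero => simp [Fin.snoc]
  | succ m ih =>
    rw [List.range_succ, List.map_append, List.prod_append, Matrix.mul_apply,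
      ← (Fin.snocEquiv fun _ => ι).sum_comp, Fintype.sum_prod_type]
    refine Finset.sum_congr rfl fun s _ => ?_
    rw [ih, Finset.sum_mul]
    refine Finset.sum_congr rfl fun a _ => ?_
    rw [Fin.prod_univ_castSucc (n := m + 1)]
    simp [Fin.snocEquiv, Fin.cons_snoc_eq_snoc_cons]

/-- The trace of a product of matrices as a sum over closed words. -/
theorem trace_list_prod {A ι : Type*} [CommSemiring A] [Fintype ι] [DecidableEq ι]
    (M : ℕ → Matrix ι ι A) (m : ℕ) [NeZero m] :
    ((List.range m).map M).prod.trace = ∑ a : ZMod m → ι, ∏ i ∈ Finset.range m,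
      M i (a (i : ZMod m)) (a ((i + 1 : ℕ) : ZMod m)) := by
  obtain ⟨m, rfl⟩ := Nat.exists_eq_succ_of_ne_zero (NeZero.ne m)
  change _ = ∑ a : Fin (m + 1) → ι, ∏ i ∈ Finset.range (m + 1),
      M i (a (Fin.ofNat (m + 1) i)) (a (Fin.ofNat (m + 1) (i + 1)))
  rw [← (Fin.consEquiv fun _ => ι).sum_comp, Fintype.sum_prod_type]
  refine Finset.sum_congr rfl fun p _ => ?_
  rw [Matrix.diag, list_prod_matrix_apply]
  refine Finset.sum_congr rfl fun a _ => ?_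
  rw [← Fin.prod_univ_eq_prod_range (fun i => M i _ _)]
  refine Finset.prod_congr rfl fun i _ => ?_
  congr 1
  · simp [Fin.consEquiv]
  · refine Fin.lastCases ?_ (fun j => ?_) i
    · simp [Fin.consEquiv]
    · have : Fin.ofNat (m + 1) ((Fin.castSucc j : ℕ) + 1) = j.succ :=
        Fin.ext (Nat.mod_eq_of_lt (by simp))
      rw [this]
      simp [Fin.consEquiv]

section

variable {ℓ : ℕ} [Fact ℓ.Prime] {b : ℕ}

/-- Reduction mod `ℓ^n` of a vector. -/
def red (n : ℕ) (v : Fin b → ℤ_[ℓ]) : Fin b → ZMod (ℓ ^ n) := fun i => PadicInt.toZModPow n (v i)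

theorem red_surjective (n : ℕ) : Function.Surjective (red (ℓ := ℓ) (b := b) n) := fun w => by
  choose v hv using fun i => ZMod.ringHom_surjective (PadicInt.toZModPow (p := ℓ) n) (w i)
  exact ⟨v, funext hv⟩

theorem toZModPow_eq_zero_iff {n : ℕ} {x : ℤ_[ℓ]} :
    PadicInt.toZModPow n x = 0 ↔ (ℓ : ℤ_[ℓ]) ^ n ∣ x := by
  rw [← RingHom.mem_ker, PadicInt.ker_toZModPow, Ideal.mem_span_singleton]

theorem red_eq_red_iff {n : ℕ} {v w : Fin b → ℤ_[ℓ]} :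
    red n v = red n w ↔ ∃ u, v - w = (ℓ : ℤ_[ℓ]) ^ n • u := by
  constructor
  · intro h
    have : ∀ i, ∃ u, v i - w i = (ℓ : ℤ_[ℓ]) ^ n * u := by
      intro i
      have : PadicInt.toZModPow n (v i - w i) = 0 := by
        rw [map_sub, sub_eq_zero]
        exact congrFun h i
      exact toZModPow_eq_zero_iff.1 this
    choose u hu using this
    exact ⟨u, funext hu⟩
  · rintro ⟨u, hu⟩
    ext i
    rw [← sub_eq_zero]
    change PadicInt.toZModPow n (v i) - PadicInt.toZModPow n (w i) = 0
    rw [← map_sub, toZModPow_eq_zero_iff]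
    exact ⟨u i, congrFun hu i⟩

theorem red_smul (n : ℕ) (c : ℤ_[ℓ]) (v : Fin b → ℤ_[ℓ]) :
    red n (c • v) = PadicInt.toZModPow n c • red n v := by
  ext i; simp [red]

theorem isUnit_toZModPow_iff {n : ℕ} (hn : 0 < n) {x : ℤ_[ℓ]} :
    IsUnit (PadicInt.toZModPow n x) ↔ IsUnit x := by
  refine ⟨fun h => ?_, fun h => h.map _⟩
  by_contra hx
  have hdvd : (ℓ : ℤ_[ℓ]) ∣ x := by
    rw [← Ideal.mem_span_singleton, ← PadicInt.maximalIdeal_eq_span_p]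
    exact hx
  have h1 : IsNilpotent (PadicInt.toZModPow n x) := by
    refine ⟨n, ?_⟩
    rw [← map_pow, toZModPow_eq_zero_iff]
    exact pow_dvd_pow_of_dvd hdvd n
  have : Nontrivial (ZMod (ℓ ^ n)) := by
    rw [ZMod.nontrivial_iff]
    exact (Nat.one_lt_pow hn.ne' (Fact.out : ℓ.Prime).one_lt).ne'
  exact h.not_isNilpotent h1

theorem not_isUnit_iff_dvd {x : ℤ_[ℓ]} : ¬ IsUnit x ↔ (ℓ : ℤ_[ℓ]) ∣ x := by
  rw [← Ideal.mem_span_singleton, ← PadicInt.maximalIdeal_eq_span_p]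
  rfl

theorem isPrimitive_red_iff {n : ℕ} (hn : 0 < n) {v : Fin b → ℤ_[ℓ]} :
    IsPrimitive (red n v) ↔ IsPrimitive v :=
  exists_congr fun _ => isUnit_toZModPow_iff hn

theorem not_isPrimitive_iff {v : Fin b → ℤ_[ℓ]} :
    ¬ IsPrimitive v ↔ ∃ u, v = (ℓ : ℤ_[ℓ]) • u := by
  unfold IsPrimitive
  push Not
  simp only [not_isUnit_iff_dvd]
  constructor
  · intro h
    choose u hu using h
    exact ⟨u, funext hu⟩
  · rintro ⟨u, rfl⟩ i
    exact ⟨u i, rfl⟩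

theorem not_isPrimitive_iff' {n : ℕ} (hn : 0 < n) {w : Fin b → ZMod (ℓ ^ n)} :
    ¬ IsPrimitive w ↔ ∃ u, w = ℓ • u := by
  obtain ⟨v, rfl⟩ := red_surjective n w
  rw [isPrimitive_red_iff hn, not_isPrimitive_iff]
  constructor
  · rintro ⟨u, rfl⟩
    refine ⟨red n u, ?_⟩
    rw [red_smul, map_natCast]
    ext i; simp
  · rintro ⟨u, hu⟩
    obtain ⟨u, rfl⟩ := red_surjective n u
    have : red n v = red n ((ℓ : ℤ_[ℓ]) • u) := by
      rw [hu, red_smul, map_natCast]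
      ext i; simp
    obtain ⟨x, hx⟩ := red_eq_red_iff.1 this
    obtain ⟨n, rfl⟩ := Nat.exists_eq_succ_of_ne_zero hn.ne'
    refine ⟨u + (ℓ : ℤ_[ℓ]) ^ n • x, ?_⟩
    rw [smul_add, smul_smul, ← pow_succ', ← hx]
    abel

section action

variable (Q : GL (Fin b) ℤ_[ℓ])

theorem act_red (n : ℕ) (m : ℤ) (v : Fin b → ℤ_[ℓ]) :
    act Q m (red n v) =
      red n (((Q ^ m : GL (Fin b) ℤ_[ℓ]) : Matrix (Fin b) (Fin b) ℤ_[ℓ]).mulVec v) := by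
  ext i
  exact (RingHom.map_mulVec (PadicInt.toZModPow n) _ v i).symm

variable {n : ℕ}

theorem act_zero (w : Fin b → ZMod (ℓ ^ n)) : act Q 0 w = w := by
  obtain ⟨v, rfl⟩ := red_surjective n w
  simp [act_red]

theorem act_act (i j : ℤ) (w : Fin b → ZMod (ℓ ^ n)) :
    act Q i (act Q j w) = act Q (i + j) w := by
  obtain ⟨v, rfl⟩ := red_surjective n w
  simp [act_red, zpow_add]

theorem act_add_vec (i : ℤ) (v w : Fin b → ZMod (ℓ ^ n)) :
    act Q i (v + w) = act Q i v + act Q i w :=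
  Matrix.mulVec_add _ _ _

theorem act_smul (i : ℤ) {R : Type*} [Monoid R] [DistribMulAction R (ZMod (ℓ ^ n))]
    [SMulCommClass R (ZMod (ℓ ^ n)) (ZMod (ℓ ^ n))] (c : R) (w : Fin b → ZMod (ℓ ^ n)) :
    act Q i (c • w) = c • act Q i w :=
  Matrix.mulVec_smul _ _ _

theorem isPrimitive_act {i : ℤ} {w : Fin b → ZMod (ℓ ^ n)} :
    IsPrimitive (act Q i w) ↔ IsPrimitive w := by
  rcases Nat.eq_zero_or_pos n with rfl | hn
  · have : Subsingleton (ZMod (ℓ ^ 0)) := by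
      rw [pow_zero]
      infer_instance
    rw [Subsingleton.elim (act Q i w) w]
  · rw [← not_iff_not, not_isPrimitive_iff' hn, not_isPrimitive_iff' hn]
    constructor
    · rintro ⟨u, hu⟩
      refine ⟨act Q (-i) u, ?_⟩
      rw [← act_smul, ← hu, act_act, neg_add_cancel, act_zero]
    · rintro ⟨u, rfl⟩
      exact ⟨act Q i u, act_smul Q i ℓ u⟩

/-- The permutation of the vectors mod `ℓ^n` given by `Q`. -/
def actPerm (n : ℕ) : Equiv.Perm (Fin b → ZMod (ℓ ^ n)) where
  toFun := act Q 1
  invFun := act Q (-1)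
  left_inv w := by rw [act_act, neg_add_cancel, act_zero]
  right_inv w := by rw [act_act, add_neg_cancel, act_zero]

theorem actPerm_apply (w : Fin b → ZMod (ℓ ^ n)) : actPerm Q n w = act Q 1 w := rfl

theorem actPerm_pow (m : ℕ) (w : Fin b → ZMod (ℓ ^ n)) : (actPerm Q n ^ m) w = act Q m w := by
  induction m with
  | zero => simp [act_zero]
  | succ m ih =>
    rw [pow_succ', Equiv.Perm.mul_apply, ih, actPerm_apply, act_act, add_comm]
    rfl

theorem actPerm_zpow (m : ℤ) (w : Fin b → ZMod (ℓ ^ n)) : (actPerm Q n ^ m) w = act Q m w := by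
  obtain ⟨m, rfl | rfl⟩ := m.eq_nat_or_neg
  · rw [zpow_natCast, actPerm_pow]
  · rw [zpow_neg, zpow_natCast, Equiv.Perm.inv_eq_iff_eq, actPerm_pow, act_act, add_neg_cancel,
      act_zero]

theorem isPeriodicPt_actPerm {m : ℕ} {w : Fin b → ZMod (ℓ ^ n)} :
    Function.IsPeriodicPt (actPerm Q n) m w ↔ act Q m w = w := by
  rw [Function.IsPeriodicPt, Function.IsFixedPt, Equiv.Perm.iterate_eq_pow, actPerm_pow]

theorem minimalPeriod_actPerm_pos (w : Fin b → ZMod (ℓ ^ n)) :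
    0 < Function.minimalPeriod (actPerm Q n) w := by
  rw [Function.minimalPeriod_pos_iff_mem_periodicPts]
  refine ⟨orderOf (actPerm Q n), orderOf_pos _, ?_⟩
  rw [Function.IsPeriodicPt, Function.IsFixedPt, Equiv.Perm.iterate_eq_pow, pow_orderOf_eq_one]
  rfl

theorem orbitSize_eq_minimalPeriod (w : Fin b → ZMod (ℓ ^ n)) :
    orbitSize Q w = Function.minimalPeriod (actPerm Q n) w := by
  have hpos := minimalPeriod_actPerm_pos Q w
  have hmem : Function.minimalPeriod (actPerm Q n) w ∈ {k : ℕ | 0 < k ∧ act Q k w = w} :=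
    ⟨hpos, (isPeriodicPt_actPerm Q).1 (Function.isPeriodicPt_minimalPeriod _ w)⟩
  refine le_antisymm (Nat.sInf_le hmem) ?_
  obtain ⟨h1, h2⟩ := Nat.sInf_mem ⟨_, hmem⟩
  exact Function.IsPeriodicPt.minimalPeriod_le h1 ((isPeriodicPt_actPerm Q).2 h2)

theorem orbitSize_pos (w : Fin b → ZMod (ℓ ^ n)) : 0 < orbitSize Q w := by
  rw [orbitSize_eq_minimalPeriod]
  exact minimalPeriod_actPerm_pos Q w

theorem orbitSize_dvd_iff {m : ℕ} {w : Fin b → ZMod (ℓ ^ n)} :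
    orbitSize Q w ∣ m ↔ act Q m w = w := by
  rw [orbitSize_eq_minimalPeriod, ← isPeriodicPt_actPerm,
    Function.isPeriodicPt_iff_minimalPeriod_dvd]

theorem act_neg_eq_self {m : ℤ} {w : Fin b → ZMod (ℓ ^ n)} (h : act Q m w = w) :
    act Q (-m) w = w := by
  conv_lhs => rw [← h, act_act, neg_add_cancel, act_zero]

end action

section congruence

/-- For `P ≡ 1` mod `ℓ`, `ℓ` odd, the matrix `1 + P + ⋯ + P^(ℓ-1)` is `ℓ` times an invertible
matrix. -/
theorem exists_geom_sum_eq (hℓ : Odd ℓ) (P M : Matrix (Fin b) (Fin b) ℤ_[ℓ])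
    (hP : P = 1 + (ℓ : ℤ_[ℓ]) • M) :
    ∃ U : GL (Fin b) ℤ_[ℓ], ∑ j ∈ Finset.range ℓ, P ^ j =
      (ℓ : ℤ_[ℓ]) • (U : Matrix (Fin b) (Fin b) ℤ_[ℓ]) := by
  have h1 : ∀ j : ℕ, ∃ N : Matrix (Fin b) (Fin b) ℤ_[ℓ],
      P ^ j = 1 + ((j : ℤ_[ℓ]) * ℓ) • M + ((ℓ : ℤ_[ℓ]) ^ 2) • N := by
    intro j
    induction j with
    | zero => exact ⟨0, by simp⟩
    | succ j ih =>
      obtain ⟨N, hN⟩ := ih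
      refine ⟨(j : ℤ_[ℓ]) • (M * M) + N + (ℓ : ℤ_[ℓ]) • (N * M), ?_⟩
      rw [pow_succ, hN, hP]
      simp only [mul_add, add_mul, one_mul, mul_one, Matrix.smul_mul, Matrix.mul_smul, smul_smul,
        smul_add, Nat.cast_add, Nat.cast_one, add_smul]
      module
  choose N hN using h1
  obtain ⟨k, hk⟩ := hℓ
  have hsum : ((∑ j ∈ Finset.range ℓ, j : ℕ) : ℤ_[ℓ]) = ℓ * k := by
    rw [Finset.sum_range_id]
    have : ℓ * (ℓ - 1) / 2 = ℓ * k := by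
      rw [show ℓ - 1 = k * 2 by omega, ← mul_assoc, Nat.mul_div_cancel _ two_pos]
    rw [this, Nat.cast_mul]
  set U : Matrix (Fin b) (Fin b) ℤ_[ℓ] :=
    1 + (ℓ : ℤ_[ℓ]) • ((k : ℤ_[ℓ]) • M + ∑ j ∈ Finset.range ℓ, N j) with hU
  have hdet : IsUnit U.det := by
    by_contra h
    have hz : PadicInt.toZMod U.det = 0 := by
      rw [← RingHom.mem_ker, PadicInt.ker_toZMod]
      exact h
    have h1 : PadicInt.toZMod.mapMatrix U = 1 := by
      ext i j
      simp [hU, Matrix.one_apply, apply_ite]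
    rw [RingHom.map_det, h1, Matrix.det_one] at hz
    exact one_ne_zero hz
  refine ⟨Matrix.GeneralLinearGroup.mk'' U hdet, ?_⟩
  change _ = (ℓ : ℤ_[ℓ]) • U
  have hs2 : ∑ j ∈ Finset.range ℓ, ((j : ℤ_[ℓ]) * ℓ) • M = (((ℓ : ℤ_[ℓ]) * k) * ℓ) • M := by
    rw [← Finset.sum_smul, ← Finset.sum_mul, ← hsum, Nat.cast_sum]
  rw [Finset.sum_congr rfl fun j _ => hN j, Finset.sum_add_distrib, Finset.sum_add_distrib, hs2,
    Finset.sum_const, Finset.card_range, ← Finset.smul_sum, hU, ← Nat.cast_smul_eq_nsmul ℤ_[ℓ]]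
  module

theorem exists_eq_one_add_smul {Q : GL (Fin b) ℤ_[ℓ]}
    (hQ : Matrix.GeneralLinearGroup.map (PadicInt.toZMod (p := ℓ)) Q = 1) (m : ℤ) :
    ∃ M : Matrix (Fin b) (Fin b) ℤ_[ℓ],
      ((Q ^ m : GL (Fin b) ℤ_[ℓ]) : Matrix (Fin b) (Fin b) ℤ_[ℓ]) = 1 + (ℓ : ℤ_[ℓ]) • M := by
  have h1 : Matrix.GeneralLinearGroup.map (PadicInt.toZMod (p := ℓ)) (Q ^ m) = 1 := by
    rw [map_zpow, hQ, one_zpow]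
  have h2 : ∀ i j, ∃ x, ((Q ^ m : GL (Fin b) ℤ_[ℓ]) : Matrix (Fin b) (Fin b) ℤ_[ℓ]) i j -
      (1 : Matrix (Fin b) (Fin b) ℤ_[ℓ]) i j = (ℓ : ℤ_[ℓ]) * x := by
    intro i j
    have h3 := congrArg (fun g : GL (Fin b) (ZMod ℓ) => (g : Matrix (Fin b) (Fin b) (ZMod ℓ)) i j) h1
    have h4 : PadicInt.toZMod (((Q ^ m : GL (Fin b) ℤ_[ℓ]) : Matrix (Fin b) (Fin b) ℤ_[ℓ]) i j -
      (1 : Matrix (Fin b) (Fin b) ℤ_[ℓ]) i j) = 0 := by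
      rw [map_sub, sub_eq_zero]
      refine h3.trans ?_
      by_cases hij : i = j <;> simp [Matrix.one_apply, hij]
    rw [← RingHom.mem_ker, PadicInt.ker_toZMod, PadicInt.maximalIdeal_eq_span_p,
      Ideal.mem_span_singleton] at h4
    exact h4
  choose M hM using h2
  refine ⟨Matrix.of M, ?_⟩
  ext i j
  rw [Matrix.add_apply, Matrix.smul_apply, Matrix.of_apply, smul_eq_mul, ← hM]
  ring

end congruence

end

section

variable {ℓ : ℕ} [Fact ℓ.Prime] {b : ℕ}

theorem coe_zpow_natCast_mul (Q : GL (Fin b) ℤ_[ℓ]) (k : ℕ) (m : ℤ) :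
    ((Q ^ ((k : ℤ) * m) : GL (Fin b) ℤ_[ℓ]) : Matrix (Fin b) (Fin b) ℤ_[ℓ]) =
      ((Q ^ m : GL (Fin b) ℤ_[ℓ]) : Matrix (Fin b) (Fin b) ℤ_[ℓ]) ^ k := by
  rw [mul_comm, zpow_mul, zpow_natCast, Units.val_pow_eq_pow_val]

theorem smul_vec_right_injective {c : ℤ_[ℓ]} (hc : c ≠ 0) {v w : Fin b → ℤ_[ℓ]}
    (h : c • v = c • w) : v = w := by
  ext i
  exact mul_left_cancel₀ hc (congrFun h i)

theorem act_prime_mul_eq_self_iff (hℓ : Odd ℓ) {Q : GL (Fin b) ℤ_[ℓ]}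
    (hQ : Matrix.GeneralLinearGroup.map (PadicInt.toZMod (p := ℓ)) Q = 1) (n : ℕ) (m : ℤ)
    (v : Fin b → ℤ_[ℓ]) :
    act Q (ℓ * m) (red (n + 1) v) = red (n + 1) v ↔ act Q m (red n v) = red n v := by
  have hℓ0 : (ℓ : ℤ_[ℓ]) ≠ 0 := by exact_mod_cast (Fact.out : ℓ.Prime).ne_zero
  obtain ⟨M, hM⟩ := exists_eq_one_add_smul hQ m
  obtain ⟨U, hU⟩ := exists_geom_sum_eq hℓ _ M hM
  have key : ((Q ^ ((ℓ : ℤ) * m) : GL (Fin b) ℤ_[ℓ]) : Matrix (Fin b) (Fin b) ℤ_[ℓ]).mulVec v - v =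
      (ℓ : ℤ_[ℓ]) • (U : Matrix (Fin b) (Fin b) ℤ_[ℓ]).mulVec
        (((Q ^ m : GL (Fin b) ℤ_[ℓ]) : Matrix (Fin b) (Fin b) ℤ_[ℓ]).mulVec v - v) := by
    rw [coe_zpow_natCast_mul, ← Matrix.smul_mulVec, ← hU]
    have h := geom_sum_mul ((Q ^ m : GL (Fin b) ℤ_[ℓ]) : Matrix (Fin b) (Fin b) ℤ_[ℓ]) ℓ
    have h2 := congrArg (fun X => Matrix.mulVec X v) h
    simp only [← Matrix.mulVec_mulVec, Matrix.sub_mulVec, Matrix.one_mulVec] at h2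
    exact h2.symm
  rw [act_red, act_red, red_eq_red_iff, red_eq_red_iff, key]
  constructor
  · rintro ⟨u, hu⟩
    rw [pow_succ', mul_smul] at hu
    have hu := smul_vec_right_injective hℓ0 hu
    refine ⟨((U⁻¹ : GL (Fin b) ℤ_[ℓ]) : Matrix (Fin b) (Fin b) ℤ_[ℓ]).mulVec u, ?_⟩
    rw [← Matrix.mulVec_smul, ← hu, Matrix.mulVec_mulVec, ← Units.val_mul, inv_mul_cancel,
      Units.val_one, Matrix.one_mulVec]
  · rintro ⟨u, hu⟩
    refine ⟨(U : Matrix (Fin b) (Fin b) ℤ_[ℓ]).mulVec u, ?_⟩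
    rw [hu, Matrix.mulVec_smul, smul_smul, ← pow_succ']

theorem act_prime_pow_eq_self_iff (hℓ : Odd ℓ) {Q : GL (Fin b) ℤ_[ℓ]}
    (hQ : Matrix.GeneralLinearGroup.map (PadicInt.toZMod (p := ℓ)) Q = 1) (n e : ℕ)
    (v : Fin b → ℤ_[ℓ]) :
    act Q ((ℓ ^ e : ℕ) : ℤ) (red (n + e) v) = red (n + e) v ↔ act Q 1 (red n v) = red n v := by
  induction e with
  | zero => simp
  | succ e ih =>
    rw [← ih, ← act_prime_mul_eq_self_iff hℓ hQ (n + e), pow_succ', Nat.cast_mul]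
    rfl

theorem act_one_red_one {Q : GL (Fin b) ℤ_[ℓ]}
    (hQ : Matrix.GeneralLinearGroup.map (PadicInt.toZMod (p := ℓ)) Q = 1) (v : Fin b → ℤ_[ℓ]) :
    act Q 1 (red 1 v) = red 1 v := by
  obtain ⟨M, hM⟩ := exists_eq_one_add_smul hQ 1
  rw [act_red, red_eq_red_iff, hM]
  exact ⟨M.mulVec v, by rw [Matrix.add_mulVec, Matrix.one_mulVec, Matrix.smul_mulVec, pow_one]; abel⟩

theorem orbitSize_dvd_pow (hℓ : Odd ℓ) {Q : GL (Fin b) ℤ_[ℓ]}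
    (hQ : Matrix.GeneralLinearGroup.map (PadicInt.toZMod (p := ℓ)) Q = 1) {n : ℕ}
    (w : Fin b → ZMod (ℓ ^ n)) : orbitSize Q w ∣ ℓ ^ n := by
  rw [orbitSize_dvd_iff]
  obtain ⟨v, rfl⟩ := red_surjective n w
  have : Subsingleton (ZMod (ℓ ^ 0)) := by
    rw [pow_zero]
    infer_instance
  have h := (act_prime_pow_eq_self_iff hℓ hQ 0 n v).2 (Subsingleton.elim _ _)
  rwa [zero_add] at h

theorem exists_isPrimitive (hb : 0 < b) : ∃ v : Fin b → ℤ_[ℓ], IsPrimitive v :=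
  ⟨fun _ => 1, ⟨⟨0, hb⟩, isUnit_one⟩⟩

/-- The largest `n` such that `Q` fixes a primitive vector mod `ℓ^n`. -/
theorem exists_max_fixed (hb : 0 < b) {Q : GL (Fin b) ℤ_[ℓ]}
    (hQ : Matrix.GeneralLinearGroup.map (PadicInt.toZMod (p := ℓ)) Q = 1)
    (hfix : ∀ v : Fin b → ℤ_[ℓ], Matrix.mulVec (Q : Matrix (Fin b) (Fin b) ℤ_[ℓ]) v = v → v = 0) :
    ∃ n₀ : ℕ, 0 < n₀ ∧
      (∃ v : Fin b → ℤ_[ℓ], IsPrimitive v ∧ act Q 1 (red n₀ v) = red n₀ v) ∧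
      ∀ n (v : Fin b → ℤ_[ℓ]), IsPrimitive v → act Q 1 (red n v) = red n v → n ≤ n₀ := by
  classical
  set N : Matrix (Fin b) (Fin b) ℤ_[ℓ] := (Q : Matrix (Fin b) (Fin b) ℤ_[ℓ]) - 1 with hN
  have hdet : N.det ≠ 0 := by
    intro h
    obtain ⟨v, hv, hNv⟩ := Matrix.exists_mulVec_eq_zero_iff.2 h
    refine hv (hfix v ?_)
    rw [hN, Matrix.sub_mulVec, Matrix.one_mulVec, sub_eq_zero] at hNv
    exact hNv
  have hbound : ∀ n (v : Fin b → ℤ_[ℓ]), IsPrimitive v → act Q 1 (red n v) = red n v →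
      (ℓ : ℤ_[ℓ]) ^ n ∣ N.det := by
    rintro n v ⟨i, hi⟩ h
    rw [act_red, red_eq_red_iff, zpow_one] at h
    obtain ⟨u, hu⟩ := h
    have h1 : N.mulVec v = (ℓ : ℤ_[ℓ]) ^ n • u := by
      rw [hN, Matrix.sub_mulVec, Matrix.one_mulVec, hu]
    have h2 : N.det • v = (ℓ : ℤ_[ℓ]) ^ n • N.adjugate.mulVec u := by
      rw [← Matrix.mulVec_smul, ← h1, Matrix.mulVec_mulVec, Matrix.adjugate_mul,
        Matrix.smul_mulVec, Matrix.one_mulVec]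
    have h3 := congrFun h2 i
    rw [Pi.smul_apply, Pi.smul_apply, smul_eq_mul, smul_eq_mul] at h3
    rw [← hi.dvd_mul_right, h3]
    exact dvd_mul_right _ _
  have hfin : FiniteMultiplicity (ℓ : ℤ_[ℓ]) N.det :=
    FiniteMultiplicity.of_not_isUnit PadicInt.prime_p.not_isUnit hdet
  obtain ⟨B, hB⟩ := hfin
  have hB' : ∀ n (v : Fin b → ℤ_[ℓ]), IsPrimitive v → act Q 1 (red n v) = red n v → n ≤ B := by
    intro n v hv h
    by_contra hn
    exact hB ((pow_dvd_pow _ (by omega)).trans (hbound n v hv h))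
  let p : ℕ → Prop := fun n => ∃ v : Fin b → ℤ_[ℓ], IsPrimitive v ∧ act Q 1 (red n v) = red n v
  obtain ⟨v, hv⟩ := exists_isPrimitive (ℓ := ℓ) hb
  have hp1 : p 1 := ⟨v, hv, act_one_red_one hQ v⟩
  have h1B : 1 ≤ B := hB' 1 v hv (act_one_red_one hQ v)
  refine ⟨Nat.findGreatest p B, ?_, Nat.findGreatest_spec h1B hp1, ?_⟩
  · exact Nat.le_findGreatest h1B hp1
  · intro n v hv h
    exact Nat.le_findGreatest (hB' n v hv h) ⟨v, hv, h⟩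

theorem pow_sub_dvd_orbitSize_red (hℓ : Odd ℓ) {Q : GL (Fin b) ℤ_[ℓ]}
    (hQ : Matrix.GeneralLinearGroup.map (PadicInt.toZMod (p := ℓ)) Q = 1) {n₀ : ℕ}
    (hmax : ∀ n (v : Fin b → ℤ_[ℓ]), IsPrimitive v → act Q 1 (red n v) = red n v → n ≤ n₀)
    (n : ℕ) {v : Fin b → ℤ_[ℓ]} (hv : IsPrimitive v) :
    ℓ ^ (n - n₀) ∣ orbitSize Q (red n v) := by
  obtain ⟨e, he, hee⟩ := (Nat.dvd_prime_pow (Fact.out : ℓ.Prime)).1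
    (orbitSize_dvd_pow hℓ hQ (red n v))
  obtain ⟨n, rfl⟩ := Nat.exists_eq_add_of_le' he
  have h := (orbitSize_dvd_iff Q).1 hee.dvd
  have := hmax n v hv ((act_prime_pow_eq_self_iff hℓ hQ n e v).1 h)
  rw [hee]
  exact pow_dvd_pow _ (by omega)

theorem pow_sub_dvd_orbitSize (hℓ : Odd ℓ) {Q : GL (Fin b) ℤ_[ℓ]}
    (hQ : Matrix.GeneralLinearGroup.map (PadicInt.toZMod (p := ℓ)) Q = 1) {n₀ : ℕ}
    (hmax : ∀ n (v : Fin b → ℤ_[ℓ]), IsPrimitive v → act Q 1 (red n v) = red n v → n ≤ n₀)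
    {n : ℕ} {w : Fin b → ZMod (ℓ ^ n)} (hw : IsPrimitive w) :
    ℓ ^ (n - n₀) ∣ orbitSize Q w := by
  rcases Nat.eq_zero_or_pos n with rfl | hn
  · simp
  · obtain ⟨v, rfl⟩ := red_surjective n w
    exact pow_sub_dvd_orbitSize_red hℓ hQ hmax n ((isPrimitive_red_iff hn).1 hw)

theorem act_pow_sub_red (hℓ : Odd ℓ) {Q : GL (Fin b) ℤ_[ℓ]}
    (hQ : Matrix.GeneralLinearGroup.map (PadicInt.toZMod (p := ℓ)) Q = 1) {n₀ : ℕ}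
    {v : Fin b → ℤ_[ℓ]} (hv : act Q 1 (red n₀ v) = red n₀ v) (n : ℕ) :
    act Q ((ℓ ^ (n - n₀) : ℕ) : ℤ) (red n v) = red n v := by
  rcases le_total n₀ n with h | h
  · obtain ⟨e, rfl⟩ := Nat.exists_eq_add_of_le h
    rw [Nat.add_sub_cancel_left]
    exact (act_prime_pow_eq_self_iff hℓ hQ n₀ e v).2 hv
  · rw [Nat.sub_eq_zero_of_le h, pow_zero]
    rw [act_red, red_eq_red_iff] at hv
    obtain ⟨u, hu⟩ := hv
    rw [act_red, red_eq_red_iff]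
    obtain ⟨e, rfl⟩ := Nat.exists_eq_add_of_le h
    exact ⟨(ℓ : ℤ_[ℓ]) ^ e • u, by rw [smul_smul, ← pow_add]; exact hu⟩

theorem minOrbitSize_eq (hℓ : Odd ℓ) {Q : GL (Fin b) ℤ_[ℓ]}
    (hQ : Matrix.GeneralLinearGroup.map (PadicInt.toZMod (p := ℓ)) Q = 1) {n₀ : ℕ}
    (h₀ : ∃ v : Fin b → ℤ_[ℓ], IsPrimitive v ∧ act Q 1 (red n₀ v) = red n₀ v)
    (hmax : ∀ n (v : Fin b → ℤ_[ℓ]), IsPrimitive v → act Q 1 (red n v) = red n v → n ≤ n₀)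
    (n : ℕ) : minOrbitSize Q n = ℓ ^ (n - n₀) := by
  obtain ⟨v, hv, hfix⟩ := h₀
  have hv0 : orbitSize Q (red n v) = ℓ ^ (n - n₀) :=
    Nat.dvd_antisymm ((orbitSize_dvd_iff Q).2 (act_pow_sub_red hℓ hQ hfix n))
      (pow_sub_dvd_orbitSize_red hℓ hQ hmax n hv)
  have hmem : ℓ ^ (n - n₀) ∈ {k : ℕ | ∃ v : Fin b → ℤ_[ℓ], IsPrimitive v ∧
      k = orbitSize Q (n := n) fun i => PadicInt.toZModPow n (v i)} := ⟨v, hv, hv0.symm⟩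
  refine le_antisymm (Nat.sInf_le hmem) ?_
  obtain ⟨w, hw, hwk⟩ := Nat.sInf_mem ⟨_, hmem⟩
  refine le_of_le_of_eq (Nat.le_of_dvd (orbitSize_pos Q _)
    (pow_sub_dvd_orbitSize_red hℓ hQ hmax n hw)) hwk.symm

end

section

variable {ℓ : ℕ} [Fact ℓ.Prime] {b : ℕ}

theorem norm_natCast_prime_lt_one : ‖(ℓ : ℂ_[ℓ])‖ < 1 := by
  have := norm_algebraMap' ℂ_[ℓ] (ℓ : ℚ_[ℓ])
  rw [map_natCast] at this
  rw [this]
  exact Padic.norm_p_lt_one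

theorem norm_ofPadicInt_le_one (x : ℤ_[ℓ]) : ‖ofPadicInt ℓ x‖ ≤ 1 :=
  (PadicComplex.norm_extends' ℓ (x : ℚ_[ℓ])).trans_le x.norm_le_one

theorem norm_natCast_le_one (m : ℕ) : ‖(m : ℂ_[ℓ])‖ ≤ 1 := by
  rw [← map_natCast (ofPadicInt ℓ)]
  exact norm_ofPadicInt_le_one _

theorem ofPadicInt_injective : Function.Injective (ofPadicInt ℓ) :=
  (algebraMap ℚ_[ℓ] ℂ_[ℓ]).injective.comp Subtype.val_injective

theorem continuous_ofPadicInt : Continuous (ofPadicInt ℓ) :=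
  (continuous_algebraMap ℚ_[ℓ] ℂ_[ℓ]).comp continuous_subtype_val

theorem norm_sub_one_lt_one_of_pow_eq_one {y : ℂ_[ℓ]} {n : ℕ} (hy : y ^ ℓ ^ n = 1) :
    ‖y - 1‖ < 1 := by
  have hp : ℓ.Prime := Fact.out
  have hy1 : ‖y‖ = 1 := by
    rw [← pow_eq_one_iff_of_nonneg (norm_nonneg y) (pow_pos hp.pos n).ne', ← norm_pow, hy, norm_one]
  have hz : ‖y - 1‖ ≤ 1 := by
    rw [sub_eq_add_neg]
    refine (IsUltrametricDist.norm_add_le_max y (-1)).trans ?_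
    rw [norm_neg, norm_one, hy1, max_self]
  have h := (Commute.all (y - 1) 1).add_pow_prime_pow_eq' hp n
  rw [sub_add_cancel, hy, one_pow] at h
  set s := ∑ k ∈ Finset.Ioo 0 (ℓ ^ n), (y - 1) ^ k * 1 ^ (ℓ ^ n - k) *
    ((ℓ ^ n).choose k / ℓ : ℕ) with hs
  have hs1 : ‖s‖ ≤ 1 := by
    refine IsUltrametricDist.norm_sum_le_of_forall_le_of_nonneg zero_le_one fun k _ => ?_
    rw [norm_mul, norm_mul, norm_pow, one_pow, norm_one, mul_one]
    exact mul_le_one₀ (pow_le_one₀ (norm_nonneg _) hz) (norm_nonneg _) (norm_natCast_le_one _)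
  have h2 : (y - 1) ^ ℓ ^ n = -(ℓ * s) := by linear_combination -h
  have h3 : ‖y - 1‖ ^ ℓ ^ n < 1 := by
    rw [← norm_pow, h2, norm_neg, norm_mul]
    exact mul_lt_one_of_nonneg_of_lt_one_left (norm_nonneg _) norm_natCast_prime_lt_one hs1
  exact lt_of_pow_lt_pow_left₀ _ zero_le_one (by rwa [one_pow])

theorem summable_evalSeries (f : MvPowerSeries (Fin b) ℤ_[ℓ]) {x : Fin b → ℂ_[ℓ]}
    (hx : ∀ i, ‖x i‖ < 1) :
    Summable fun m : Fin b →₀ ℕ => ofPadicInt ℓ (MvPowerSeries.coeff m f) * ∏ i, x i ^ m i := by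
  apply NonarchimedeanAddGroup.summable_of_tendsto_cofinite_zero
  rw [tendsto_zero_iff_norm_tendsto_zero]
  obtain ⟨r, hr0, hr1, hr⟩ : ∃ r : ℝ, 0 ≤ r ∧ r < 1 ∧ ∀ i, ‖x i‖ ≤ r := by
    rcases isEmpty_or_nonempty (Fin b) with hb | hb
    · exact ⟨0, le_rfl, zero_lt_one, fun i => (hb.false i).elim⟩
    · obtain ⟨i, hi⟩ := Finite.exists_max fun i => ‖x i‖
      exact ⟨‖x i‖, norm_nonneg _, hx i, hi⟩
  have hdeg : Filter.Tendsto (fun m : Fin b →₀ ℕ => ∑ i, m i) Filter.cofinite Filter.atTop := by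
    rw [Filter.tendsto_atTop]
    intro D
    rw [Filter.eventually_cofinite]
    refine (Set.finite_Iic (Finsupp.equivFunOnFinite.symm fun _ : Fin b => D)).subset ?_
    intro m hm i
    have h1 := Finset.single_le_sum (f := fun i => m i) (fun _ _ => Nat.zero_le _) (Finset.mem_univ i)
    have h2 : ¬ D ≤ ∑ i, m i := hm
    have h3 : m i ≤ ∑ i, m i := h1
    change m i ≤ D
    omega
  refine squeeze_zero (fun _ => norm_nonneg _) (fun m => ?_)
    ((tendsto_pow_atTop_nhds_zero_of_lt_one hr0 hr1).comp hdeg)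
  rw [norm_mul, norm_prod]
  refine (mul_le_of_le_one_left (Finset.prod_nonneg fun _ _ => norm_nonneg _)
    (norm_ofPadicInt_le_one _)).trans ?_
  rw [Function.comp_apply, ← Finset.prod_pow_eq_pow_sum]
  refine Finset.prod_le_prod (fun _ _ => norm_nonneg _) fun i _ => ?_
  rw [norm_pow]
  exact pow_le_pow_left₀ (norm_nonneg _) (hr i) _

/-- The functions on `(ℤ/ℓ^n)^b` that are `ℤ_ℓ`-combinations of characters. -/
def charSubring {n : ℕ} (ψ : AddChar (ZMod (ℓ ^ n)) ℂ_[ℓ]) :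
    Subring ((Fin b → ZMod (ℓ ^ n)) → ℂ_[ℓ]) where
  carrier := Set.range fun (c : (Fin b → ZMod (ℓ ^ n)) → ℤ_[ℓ]) v =>
    ∑ x, ofPadicInt ℓ (c x) * ψ (x ⬝ᵥ v)
  zero_mem' := ⟨0, by ext; simp⟩
  one_mem' := ⟨Pi.single 0 1, by
    ext v
    beta_reduce
    rw [Finset.sum_eq_single 0]
    · simp
    · intro x _ hx
      simp [hx]
    · simp⟩
  add_mem' := by
    rintro _ _ ⟨c, rfl⟩ ⟨d, rfl⟩
    exact ⟨c + d, by ext v; simp [add_mul, Finset.sum_add_distrib]⟩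
  neg_mem' := by
    rintro _ ⟨c, rfl⟩
    exact ⟨-c, by ext v; simp⟩
  mul_mem' := by
    rintro _ _ ⟨c, rfl⟩ ⟨d, rfl⟩
    refine ⟨fun z => ∑ x, c x * d (z - x), ?_⟩
    ext v
    simp only [map_sum, map_mul, Pi.mul_apply, Finset.sum_mul]
    rw [Finset.sum_comm]
    refine Finset.sum_congr rfl fun x _ => ?_
    rw [Finset.mul_sum, ← Equiv.sum_comp (Equiv.addLeft x)]
    refine Finset.sum_congr rfl fun y _ => ?_
    simp only [Equiv.coe_addLeft, add_sub_cancel_left, add_dotProduct, AddChar.map_add_eq_mul]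
    ring

theorem isClosed_charSubring {n : ℕ} (ψ : AddChar (ZMod (ℓ ^ n)) ℂ_[ℓ]) :
    IsClosed (charSubring (b := b) ψ : Set ((Fin b → ZMod (ℓ ^ n)) → ℂ_[ℓ])) := by
  refine (isCompact_range ?_).isClosed
  refine continuous_pi fun v => continuous_finsetSum _ fun x _ => ?_
  exact (continuous_ofPadicInt.comp (continuous_apply x)).mul continuous_const

/-- The Fourier expansion of the values of a power series at roots of unity. -/
theorem exists_fourier {n : ℕ} {ζ : ℂ_[ℓ]} (hζ : ζ ^ ℓ ^ n = 1)
    (f : MvPowerSeries (Fin b) ℤ_[ℓ]) :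
    ∃ c : (Fin b → ZMod (ℓ ^ n)) → ℤ_[ℓ], ∀ v : Fin b → ZMod (ℓ ^ n),
      evalSeries f (fun i => ζ ^ (v i).val - 1) =
        ∑ x, ofPadicInt ℓ (c x) * AddChar.zmodChar (ℓ ^ n) hζ (x ⬝ᵥ v) := by
  set ψ := AddChar.zmodChar (ℓ ^ n) hζ with hψ
  suffices h : (fun v : Fin b → ZMod (ℓ ^ n) => evalSeries f fun i => ζ ^ (v i).val - 1) ∈
      charSubring ψ by
    obtain ⟨c, hc⟩ := h
    exact ⟨c, fun v => (congrFun hc v).symm⟩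
  have hlt : ∀ (v : Fin b → ZMod (ℓ ^ n)) i, ‖ζ ^ (v i).val - 1‖ < 1 := by
    intro v i
    refine norm_sub_one_lt_one_of_pow_eq_one (n := n) ?_
    rw [← pow_mul, mul_comm, pow_mul, hζ, one_pow]
  have hconst : ∀ a : ℤ_[ℓ], (fun _ : Fin b → ZMod (ℓ ^ n) => ofPadicInt ℓ a) ∈
      charSubring ψ := by
    intro a
    refine ⟨Pi.single 0 a, ?_⟩
    ext v
    beta_reduce
    rw [Finset.sum_eq_single 0]
    · simp
    · intro x _ hx
      simp [hx]
    · simp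
  have hcoord : ∀ i, (fun v : Fin b → ZMod (ℓ ^ n) => ζ ^ (v i).val - 1) ∈ charSubring ψ := by
    intro i
    refine sub_mem (?_ : (fun v : Fin b → ZMod (ℓ ^ n) => ζ ^ (v i).val) ∈ _) (one_mem _)
    refine ⟨Pi.single (Pi.single i 1) 1, ?_⟩
    ext v
    beta_reduce
    rw [Finset.sum_eq_single (Pi.single i 1)]
    · simp [hψ, AddChar.zmodChar_apply]
    · intro x _ hx
      simp [hx]
    · simp
  have hsum : HasSum (fun (m : Fin b →₀ ℕ) (v : Fin b → ZMod (ℓ ^ n)) =>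
      ofPadicInt ℓ (MvPowerSeries.coeff m f) * ∏ i, (ζ ^ (v i).val - 1) ^ m i)
      (fun v => evalSeries f fun i => ζ ^ (v i).val - 1) := by
    rw [Pi.hasSum]
    exact fun v => (summable_evalSeries f (hlt v)).hasSum
  refine (isClosed_charSubring ψ).mem_of_tendsto hsum (Filter.Eventually.of_forall fun s => ?_)
  refine sum_mem fun m _ => ?_
  have : (fun v : Fin b → ZMod (ℓ ^ n) =>
      ofPadicInt ℓ (MvPowerSeries.coeff m f) * ∏ i, (ζ ^ (v i).val - 1) ^ m i) =
      (fun _ => ofPadicInt ℓ (MvPowerSeries.coeff m f)) *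
        ∏ i, (fun v : Fin b → ZMod (ℓ ^ n) => ζ ^ (v i).val - 1) ^ m i := by
    ext v
    simp
  rw [this]
  exact mul_mem (hconst _) (prod_mem fun i _ => pow_mem (hcoord i) _)

end

section

variable {ℓ : ℕ} [Fact ℓ.Prime] {b r : ℕ}

/-- The product `F(ζ^{Q^{-1} w}) ⋯ F(ζ^{Q^{-m} w})`. -/
def matProd (Q : GL (Fin b) ℤ_[ℓ]) (F : Matrix (Fin r) (Fin r) (MvPowerSeries (Fin b) ℤ_[ℓ]))
    {n : ℕ} (ζ : ℂ_[ℓ]) (m : ℕ) (w : Fin b → ZMod (ℓ ^ n)) : Matrix (Fin r) (Fin r) ℂ_[ℓ] :=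
  ((List.range m).map fun i : ℕ => evalAtRoot F ζ (act Q (-((i : ℤ) + 1)) w)).prod

open Classical in
/-- The primitive vectors mod `ℓ^n` fixed by `Q^m`. -/
def primFixed (Q : GL (Fin b) ℤ_[ℓ]) (n : ℕ) (m : ℤ) : Finset (Fin b → ZMod (ℓ ^ n)) :=
  Finset.univ.filter fun w => IsPrimitive w ∧ act Q m w = w

theorem mem_primFixed {Q : GL (Fin b) ℤ_[ℓ]} {n : ℕ} {m : ℤ} {w : Fin b → ZMod (ℓ ^ n)} :
    w ∈ primFixed Q n m ↔ IsPrimitive w ∧ act Q m w = w := by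
  simp [primFixed]

theorem act_mem_primFixed {Q : GL (Fin b) ℤ_[ℓ]} {n : ℕ} {m : ℤ} (i : ℤ)
    {w : Fin b → ZMod (ℓ ^ n)} : act Q i w ∈ primFixed Q n m ↔ w ∈ primFixed Q n m := by
  rw [mem_primFixed, mem_primFixed, isPrimitive_act, act_act, add_comm, ← act_act]
  refine and_congr_right fun _ => ⟨fun h => ?_, fun h => by rw [h]⟩
  have := congrArg (act Q (-i)) h
  rwa [act_act Q (-i) i, act_act Q (-i) i, neg_add_cancel, act_zero, act_zero] at this

/-- The sum of the traces of `matProd` over the primitive vectors fixed by `Q^m`. -/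
def traceSum (Q : GL (Fin b) ℤ_[ℓ]) (F : Matrix (Fin r) (Fin r) (MvPowerSeries (Fin b) ℤ_[ℓ]))
    (n : ℕ) (ζ : ℂ_[ℓ]) (m : ℕ) : ℂ_[ℓ] :=
  ∑ w ∈ primFixed Q n m, (matProd Q F ζ m w).trace

section

variable (Q : GL (Fin b) ℤ_[ℓ]) (F : Matrix (Fin r) (Fin r) (MvPowerSeries (Fin b) ℤ_[ℓ]))
  {n : ℕ} (ζ : ℂ_[ℓ])

theorem matA_eq_matProd (w : Fin b → ZMod (ℓ ^ n)) :
    matA Q F ζ w = matProd Q F ζ (orbitSize Q w) w := by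
  simp only [matA, matProd, List.bind_eq_flatMap, List.pure_def, ← List.map_eq_flatMap,
    List.map_map]
  rfl

theorem trace_matProd_act {m : ℕ} {w : Fin b → ZMod (ℓ ^ n)} (hw : act Q m w = w) :
    (matProd Q F ζ m (act Q 1 w)).trace = (matProd Q F ζ m w).trace := by
  rcases m with _ | m
  · simp [matProd]
  · unfold matProd
    rw [List.range_succ_eq_map, List.map_cons, List.prod_cons, Matrix.trace_mul_comm,
      ← List.range_succ_eq_map, List.range_succ, List.map_append, List.prod_append, List.map_map]
    congr 2
    · refine congrArg List.prod (List.map_congr_left fun i _ => ?_)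
      rw [Function.comp_apply, act_act]
      congr 2
    · rw [List.map_singleton, List.prod_singleton, act_act]
      congr 1
      have h := act_neg_eq_self Q hw
      push_cast at h ⊢
      rw [h]
      exact act_zero Q w

theorem matProd_mul {k : ℕ} {w : Fin b → ZMod (ℓ ^ n)} (hw : act Q k w = w) (j : ℕ) :
    matProd Q F ζ (k * j) w = matProd Q F ζ k w ^ j := by
  induction j with
  | zero => simp [matProd]
  | succ j ih =>
    rw [pow_succ', ← ih, mul_add, mul_one, add_comm]
    unfold matProd
    rw [List.range_add, List.map_append, List.prod_append, List.map_map]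
    congr 2
    refine List.map_congr_left fun i _ => ?_
    rw [Function.comp_apply]
    conv_rhs => rw [← act_neg_eq_self Q hw, act_act]
    congr 2
    push_cast
    ring

theorem hasLogDeriv_polyP (v : Fin b → ZMod (ℓ ^ n)) {k : ℕ} (hk : 0 < k) :
    HasLogDeriv (((polyP Q F ζ v).comp (Polynomial.X ^ k) : ℂ_[ℓ][X]) : PowerSeries ℂ_[ℓ])
      (fun j => if k ∣ j then k * (matProd Q F ζ (orbitSize Q v * (j / k)) v).trace else 0) := by
  have hfix : act Q (orbitSize Q v) v = v := (orbitSize_dvd_iff Q).1 dvd_rfl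
  simp only [matProd_mul Q F ζ hfix, ← matA_eq_matProd]
  convert hasLogDeriv_det (matA Q F ζ v) hk using 1
  rw [polyP, ← Polynomial.coe_compRingHom_apply, RingHom.map_det,
    ← Polynomial.coeToPowerSeries.ringHom_apply, RingHom.map_det]
  congr 1
  ext1 p q
  by_cases hpq : p = q <;> simp [hpq] <;> exact mul_comm _ _

theorem hasLogDeriv_polyR {S : Finset (Fin b → ZMod (ℓ ^ n))} (hS : IsOrbitReps Q S) {k : ℕ}
    (hk : minOrbitSize Q n = k) (hk0 : 0 < k) (hdvd : ∀ v ∈ S, k ∣ orbitSize Q v) :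
    ∃ t : ℕ → ℂ_[ℓ], HasLogDeriv (polyR Q F ζ S : PowerSeries ℂ_[ℓ]) t ∧
      ∀ j, k * t j = traceSum Q F n ζ (j * k) := by
  classical
  have hpos : ∀ v ∈ S, 0 < orbitSize Q v / k := fun v hv =>
    Nat.div_pos (Nat.le_of_dvd (orbitSize_pos Q v) (hdvd v hv)) hk0
  have hprod := HasLogDeriv.prod S fun v hv => hasLogDeriv_polyP Q F ζ v (hpos v hv)
  have hR : (polyR Q F ζ S : PowerSeries ℂ_[ℓ]) = ∏ v ∈ S, (((polyP Q F ζ v).comp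
      (Polynomial.X ^ (orbitSize Q v / k)) : ℂ_[ℓ][X]) : PowerSeries ℂ_[ℓ]) := by
    rw [polyR, ← Polynomial.coeToPowerSeries.ringHom_apply, map_prod, hk]
    rfl
  rw [← hR] at hprod
  refine ⟨_, hprod, ?_⟩
  intro j
  rw [traceSum, ← Fintype.sum_ite_mem (primFixed Q n _), sum_eq_sum_minimalPeriod_mul (actPerm Q n) _ ?_ S ?_,
    Finset.sum_apply, Finset.mul_sum]
  · refine Finset.sum_congr rfl fun v hv => ?_
    obtain ⟨o, ho⟩ := hdvd v hv
    have ho0 : 0 < o := Nat.pos_of_ne_zero fun h => by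
      have := orbitSize_pos Q v
      simp [ho, h] at this
    rw [← orbitSize_eq_minimalPeriod]
    have h1 : orbitSize Q v / k = o := by rw [ho, Nat.mul_div_cancel_left _ hk0]
    have h2 : v ∈ primFixed Q n (j * k : ℕ) ↔ o ∣ j := by
      rw [mem_primFixed, ← orbitSize_dvd_iff, ho, mul_comm j, Nat.mul_dvd_mul_iff_left hk0]
      exact and_iff_right (hS.1 v hv)
    rw [h1]
    simp only [h2]
    split_ifs with hj
    · obtain ⟨i, rfl⟩ := hj
      rw [Nat.mul_div_cancel_left _ ho0, ho, Nat.cast_mul, mul_assoc (k : ℂ_[ℓ]),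
        mul_assoc k o i, mul_comm k (o * i)]
    · simp
  · intro w
    rw [actPerm_apply]
    simp only [act_mem_primFixed]
    split_ifs with h
    · exact trace_matProd_act Q F ζ (mem_primFixed.1 h).2
    · rfl
  · intro w hw
    have hp : IsPrimitive w := by
      by_contra h
      exact hw (if_neg fun h' => h (mem_primFixed.1 h').1)
    obtain ⟨v, ⟨hv, m, hm⟩, huniq⟩ := hS.2 w hp
    refine ⟨v, ⟨hv, m, by rw [actPerm_zpow, hm]⟩, ?_⟩
    rintro v' ⟨hv', m', hm'⟩
    exact huniq v' ⟨hv', m', by rw [← actPerm_zpow, hm']⟩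

end

end

section

variable {ℓ : ℕ} [Fact ℓ.Prime] {b r : ℕ}

section words

theorem prod_range_sum {A X : Type*} [CommSemiring A] [Fintype X] (m : ℕ) [NeZero m]
    (g : ℕ → X → A) :
    ∏ i ∈ Finset.range m, ∑ x, g i x =
      ∑ x : ZMod m → X, ∏ i ∈ Finset.range m, g i (x (i : ZMod m)) := by
  classical
  obtain ⟨m, rfl⟩ := Nat.exists_eq_succ_of_ne_zero (NeZero.ne m)
  change _ = ∑ x : Fin (m + 1) → X, ∏ i ∈ Finset.range (m + 1), g i (x (Fin.ofNat (m + 1) i))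
  rw [← Fin.prod_univ_eq_prod_range (fun i => ∑ x, g i x), Finset.prod_univ_sum,
    Fintype.piFinset_univ]
  refine Finset.sum_congr rfl fun x _ => ?_
  rw [← Fin.prod_univ_eq_prod_range (fun i => g i _)]
  refine Finset.prod_congr rfl fun i _ => ?_
  congr 2
  exact Fin.ext (Nat.mod_eq_of_lt i.2).symm

variable {X : Type*}

/-- The weight of a word of length `k`. -/
def wt (f : Fin r → Fin r → X → ℤ_[ℓ]) (k : ℕ) (c : ℕ → Fin r × X) : ℤ_[ℓ] :=
  ∏ i ∈ Finset.range k, f (c i).1 (c (i + 1)).1 (c i).2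

/-- The periodic sequence attached to a cyclic word. -/
def unroll {α : Type*} {m : ℕ} (c : ZMod m → α) : ℕ → α := fun i => c (i : ZMod m)

theorem addChar_map_sum {ι A M : Type*} [AddCommMonoid A] [CommMonoid M] (ψ : AddChar A M)
    (s : Finset ι) (g : ι → A) : ψ (∑ i ∈ s, g i) = ∏ i ∈ s, ψ (g i) := by
  classical
  induction s using Finset.induction_on with
  | empty => simp
  | insert a s ha ih => rw [Finset.sum_insert ha, Finset.prod_insert ha, ψ.map_add_eq_mul, ih]

/-- The trace of a product of matrices whose entries are combinations of characters, as a sum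
over cyclic words. -/
theorem trace_list_prod_char {n : ℕ} (ψ : AddChar (ZMod (ℓ ^ n)) ℂ_[ℓ])
    (f : Fin r → Fin r → (Fin b → ZMod (ℓ ^ n)) → ℤ_[ℓ])
    (M : ℕ → Matrix (Fin r) (Fin r) ℂ_[ℓ]) (u : ℕ → Fin b → ZMod (ℓ ^ n))
    (hM : ∀ i p q, M i p q = ∑ x, ofPadicInt ℓ (f p q x) * ψ (x ⬝ᵥ u i)) (m : ℕ) [NeZero m] :
    ((List.range m).map M).prod.trace =
      ∑ c : ZMod m → Fin r × (Fin b → ZMod (ℓ ^ n)), ofPadicInt ℓ (wt f m (unroll c)) *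
        ψ (∑ i ∈ Finset.range m, (unroll c i).2 ⬝ᵥ u i) := by
  rw [trace_list_prod, ← (Equiv.arrowProdEquivProdArrow _ _ _).symm.sum_comp,
    Fintype.sum_prod_type]
  refine Finset.sum_congr rfl fun a _ => ?_
  simp only [hM]
  rw [prod_range_sum]
  refine Finset.sum_congr rfl fun x _ => ?_
  rw [Finset.prod_mul_distrib, wt, map_prod, addChar_map_sum]
  rfl

theorem prod_range_mul_of_periodic {A : Type*} [CommMonoid A] (g : ℕ → A) (d : ℕ)
    (hg : ∀ i, g (i + d) = g i) (k : ℕ) :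
    ∏ i ∈ Finset.range (d * k), g i = (∏ i ∈ Finset.range d, g i) ^ k := by
  have hg' : ∀ k i, g (d * k + i) = g i := by
    intro k i
    induction k with
    | zero => simp
    | succ k ih => rw [← ih, ← hg (d * k + i)]; congr 1; ring
  induction k with
  | zero => simp
  | succ k ih =>
    rw [mul_add, mul_one, Finset.prod_range_add, ih, pow_succ]
    simp only [hg']

@[to_additive]
theorem prod_range_succ_of_periodic {A : Type*} [CommMonoid A] (g : ℕ → A) (d : ℕ)
    (hg : g d = g 0) :
    ∏ i ∈ Finset.range d, g (i + 1) = ∏ i ∈ Finset.range d, g i := by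
  rcases d with _ | d
  · rfl
  · rw [Finset.prod_range_succ, Finset.prod_range_succ', hg]

theorem wt_mul_of_periodic (f : Fin r → Fin r → X → ℤ_[ℓ]) {d : ℕ} {c : ℕ → Fin r × X}
    (hc : ∀ i, c (i + d) = c i) (k : ℕ) : wt f (d * k) c = wt f d c ^ k :=
  prod_range_mul_of_periodic _ d (fun i => by rw [hc, add_right_comm, hc]) k

theorem wt_shift (f : Fin r → Fin r → X → ℤ_[ℓ]) {d : ℕ} {c : ℕ → Fin r × X}
    (hc : ∀ i, c (i + d) = c i) : wt f d (fun i => c (i + 1)) = wt f d c := by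
  refine prod_range_succ_of_periodic (fun i => f (c i).1 (c (i + 1)).1 (c i).2) d ?_
  rw [← hc 0, ← hc (0 + 1), zero_add, add_comm 1 d]

/-- The rotation of cyclic words. -/
def rot (m : ℕ) (α : Type*) : Equiv.Perm (ZMod m → α) where
  toFun c i := c (i + 1)
  invFun c i := c (i - 1)
  left_inv c := by ext i; simp
  right_inv c := by ext i; simp

theorem rot_pow_apply {m : ℕ} {α : Type*} (k : ℕ) (c : ZMod m → α) (i : ZMod m) :
    (rot m α ^ k) c i = c (i + k) := by
  induction k generalizing c with
  | zero => simp
  | succ k ih =>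
    rw [pow_succ, Equiv.Perm.mul_apply, ih]
    simp [rot, add_assoc]

theorem unroll_rot {m : ℕ} {α : Type*} (c : ZMod m → α) :
    unroll (rot m α c) = fun i => unroll c (i + 1) := by
  ext1 i
  simp [unroll, rot]

theorem unroll_periodic {m : ℕ} {α : Type*} (c : ZMod m → α) (i : ℕ) :
    unroll c (i + m) = unroll c i := by
  simp [unroll]

theorem unroll_add_of_rot_pow {m d : ℕ} {α : Type*} {c : ZMod m → α}
    (hc : (rot m α ^ d) c = c) (i : ℕ) : unroll c (i + d) = unroll c i := by
  have := congrFun hc (i : ZMod m)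
  rw [rot_pow_apply] at this
  simpa [unroll] using this

/-- Cyclic words of length `m` correspond to the `m`-periodic cyclic words of length `k m`. -/
theorem sum_unroll_eq_sum_periodic {A α : Type*} [AddCommMonoid A] [Fintype α] [DecidableEq α]
    {k m : ℕ} [NeZero m] [NeZero (k * m)] (Y : (ℕ → α) → A) :
    ∑ c : ZMod m → α, Y (unroll c) =
      ∑ c : ZMod (k * m) → α, if (rot (k * m) α ^ m) c = c then Y (unroll c) else 0 := by
  rw [← Finset.sum_filter]
  have hcast : ∀ i : ℕ, ((i : ZMod (k * m)).cast : ZMod m) = i := fun i =>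
    ZMod.cast_natCast (Dvd.intro_left k rfl) i
  refine Finset.sum_bij (fun c _ i => c (i.cast : ZMod m)) ?_ ?_ ?_ ?_
  · intro c _
    rw [Finset.mem_filter]
    refine ⟨Finset.mem_univ _, ?_⟩
    ext1 i
    rw [rot_pow_apply, ← ZMod.natCast_zmod_val i, ← Nat.cast_add, hcast, hcast]
    simp
  · intro c _ c' _ h
    ext1 i
    have h2 := congrFun h (i.val : ZMod (k * m))
    beta_reduce at h2
    rwa [hcast, ZMod.natCast_zmod_val] at h2
  · intro c hc
    have hper : ∀ i j : ℕ, unroll c (i + m * j) = unroll c i := by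
      intro i j
      induction j with
      | zero => rfl
      | succ j ih =>
        rw [mul_add, mul_one, ← add_assoc,
          unroll_add_of_rot_pow (Finset.mem_filter.1 hc).2, ih]
    refine ⟨fun i => unroll c i.val, Finset.mem_univ _, ?_⟩
    ext1 i
    obtain ⟨j, rfl⟩ : ∃ j : ℕ, (j : ZMod (k * m)) = i := ⟨i.val, ZMod.natCast_zmod_val i⟩
    beta_reduce
    rw [hcast, ZMod.val_natCast]
    conv_rhs => rw [← Nat.mod_add_div j m]
    exact (hper _ _).symm
  · intro c _
    congr 1
    ext1 i
    simp [unroll, hcast]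

theorem pow_dvd_pow_prime_pow_sub (ω : ℤ_[ℓ]) (a : ℕ) :
    (ℓ : ℤ_[ℓ]) ^ (a + 1) ∣ ω ^ ℓ ^ (a + 1) - ω ^ ℓ ^ a := by
  have h : (ℓ : ℤ_[ℓ]) ∣ ω ^ ℓ - ω := by
    rw [← Ideal.mem_span_singleton, ← PadicInt.maximalIdeal_eq_span_p, ← PadicInt.ker_toZMod,
      RingHom.mem_ker, map_sub, map_pow, ZMod.pow_card, sub_self]
  have := dvd_sub_pow_of_dvd_sub h a
  rwa [← pow_mul, ← pow_succ'] at this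

end words

section sums

variable (Q : GL (Fin b) ℤ_[ℓ])

/-- The non-primitive vectors mod `ℓ^n` fixed by `Q^m`. -/
def nonprimFixed (n : ℕ) (m : ℤ) : AddSubgroup (Fin b → ZMod (ℓ ^ n)) where
  carrier := {w | act Q m w = w ∧ ∃ u : Fin b → ZMod (ℓ ^ n), w = ℓ • u}
  zero_mem' := ⟨Matrix.mulVec_zero _, 0, by simp⟩
  add_mem' := by
    rintro _ _ ⟨h1, u, rfl⟩ ⟨h2, v, rfl⟩
    exact ⟨by rw [act_add_vec, h1, h2], u + v, by rw [smul_add]⟩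
  neg_mem' := by
    rintro _ ⟨h1, u, rfl⟩
    exact ⟨(Matrix.mulVec_neg _ _).trans (congrArg _ h1), -u, by rw [smul_neg]⟩

/-- The vectors mod `ℓ^n` fixed by `Q^m`. -/
def fixedVec (n : ℕ) (m : ℤ) : AddSubgroup (Fin b → ZMod (ℓ ^ n)) where
  carrier := {w | act Q m w = w}
  zero_mem' := Matrix.mulVec_zero _
  add_mem' := by
    intro v w h1 h2
    exact (act_add_vec Q m v w).trans (congrArg₂ _ h1 h2)
  neg_mem' := by
    intro w h1
    exact (Matrix.mulVec_neg _ _).trans (congrArg _ h1)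

open Classical in
theorem sum_addChar_subgroup {A : Type*} [AddCommGroup A] [Fintype A] (K : AddSubgroup A)
    (χ : AddChar A ℂ_[ℓ]) :
    ∃ u : ℤ, ∑ w : A, (if w ∈ K then χ w else 0) = u ∧ (Nat.card K : ℤ) ∣ u := by
  have h : ∑ w : A, (if w ∈ K then χ w else 0) = ∑ w : K, χ.compAddMonoidHom K.subtype w := by
    rw [← Finset.sum_filter]
    exact Finset.sum_subtype _ (by simp) _
  rw [h, AddChar.sum_eq_ite]
  split_ifs
  · exact ⟨Nat.card K, by simp, dvd_rfl⟩
  · exact ⟨0, by simp, dvd_zero _⟩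

theorem exists_int_sum_primFixed {n : ℕ} (hn : 0 < n) (m : ℤ)
    (χ : AddChar (Fin b → ZMod (ℓ ^ n)) ℂ_[ℓ]) :
    ∃ u : ℤ, ∑ w ∈ primFixed Q n m, χ w = u ∧ (Nat.card (nonprimFixed Q n m) : ℤ) ∣ u := by
  classical
  obtain ⟨u, hu, hdu⟩ := sum_addChar_subgroup (fixedVec Q n m) χ
  obtain ⟨u', hu', hdu'⟩ := sum_addChar_subgroup (nonprimFixed Q n m) χ
  refine ⟨u - u', ?_, dvd_sub (dvd_trans ?_ hdu) hdu'⟩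
  · rw [Int.cast_sub, ← hu, ← hu', ← Finset.sum_sub_distrib,
      ← Fintype.sum_ite_mem (primFixed Q n m)]
    refine Finset.sum_congr rfl fun w _ => ?_
    have h1 : w ∈ primFixed Q n m ↔ act Q m w = w ∧ ¬ ∃ u : Fin b → ZMod (ℓ ^ n), w = ℓ • u := by
      rw [mem_primFixed, ← not_isPrimitive_iff' hn, not_not, and_comm]
    have h2 : w ∈ fixedVec Q n m ↔ act Q m w = w := Iff.rfl
    have h3 : w ∈ nonprimFixed Q n m ↔ act Q m w = w ∧ ∃ u : Fin b → ZMod (ℓ ^ n), w = ℓ • u :=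
      Iff.rfl
    simp only [h1, h2, h3]
    clear h1 h2 h3 hu hu'
    by_cases h4 : act Q m w = w <;> by_cases h5 : ∃ u : Fin b → ZMod (ℓ ^ n), w = ℓ • u <;>
      simp only [h4, h5] <;> simp
  · exact Int.natCast_dvd_natCast.2 (AddSubgroup.card_dvd_of_le fun w hw => hw.1)

theorem exists_int_sum_primFixed' (n : ℕ) (m : ℤ)
    (χ : AddChar (Fin b → ZMod (ℓ ^ n)) ℂ_[ℓ]) :
    ∃ u : ℤ, ∑ w ∈ primFixed Q n m, χ w = u := by
  rcases Nat.eq_zero_or_pos n with rfl | hn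
  · have : Subsingleton (ZMod (ℓ ^ 0)) := by
      rw [pow_zero]
      infer_instance
    refine ⟨(primFixed Q 0 m).card, ?_⟩
    have h : ∀ w, χ w = 1 := fun w => by rw [Subsingleton.elim w 0, AddChar.map_zero_eq_one]
    rw [Finset.sum_congr rfl fun w _ => h w, Finset.sum_const, nsmul_eq_mul, mul_one,
      Int.cast_natCast]
  · obtain ⟨u, hu, _⟩ := exists_int_sum_primFixed Q hn m χ
    exact ⟨u, hu⟩

/-- The exponent attached to a word of length `k` and a vector. -/
def phase {n : ℕ} (k : ℕ) (x : ℕ → Fin b → ZMod (ℓ ^ n)) :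
    (Fin b → ZMod (ℓ ^ n)) →+ ZMod (ℓ ^ n) where
  toFun w := ∑ i ∈ Finset.range k, x i ⬝ᵥ act Q (-((i : ℤ) + 1)) w
  map_zero' := by simp [act]
  map_add' v w := by simp [act_add_vec, dotProduct_add, Finset.sum_add_distrib]

theorem phase_apply {n : ℕ} (k : ℕ) (x : ℕ → Fin b → ZMod (ℓ ^ n)) (w : Fin b → ZMod (ℓ ^ n)) :
    phase Q k x w = ∑ i ∈ Finset.range k, x i ⬝ᵥ act Q (-((i : ℤ) + 1)) w := rfl

variable (F : Matrix (Fin r) (Fin r) (MvPowerSeries (Fin b) ℤ_[ℓ]))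

theorem exists_fourier_matrix {n : ℕ} {ζ : ℂ_[ℓ]} (hζ : ζ ^ ℓ ^ n = 1) :
    ∃ f : Fin r → Fin r → (Fin b → ZMod (ℓ ^ n)) → ℤ_[ℓ],
      ∀ (v : Fin b → ZMod (ℓ ^ n)) (p q : Fin r), evalAtRoot F ζ v p q =
        ∑ x, ofPadicInt ℓ (f p q x) * AddChar.zmodChar (ℓ ^ n) hζ (x ⬝ᵥ v) := by
  choose f hf using fun p q => exists_fourier (b := b) hζ (F p q)
  exact ⟨f, fun v p q => hf p q v⟩

theorem exists_traceSum_eq {n : ℕ} {ζ : ℂ_[ℓ]} (hζ : ζ ^ ℓ ^ n = 1) {m : ℕ} (hm : 0 < m) :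
    ∃ z : ℤ_[ℓ], traceSum Q F n ζ m = ofPadicInt ℓ z := by
  have : NeZero m := ⟨hm.ne'⟩
  obtain ⟨f, hf⟩ := exists_fourier_matrix F hζ
  set ψ := AddChar.zmodChar (ℓ ^ n) hζ
  choose u hu using fun c : ZMod m → Fin r × (Fin b → ZMod (ℓ ^ n)) =>
    exists_int_sum_primFixed' Q n m (ψ.compAddMonoidHom (phase Q m fun i => (unroll c i).2))
  refine ⟨∑ c, wt f m (unroll c) * u c, ?_⟩
  simp only [traceSum, matProd]
  rw [Finset.sum_congr rfl fun w _ => trace_list_prod_char ψ f _ _ (fun i => hf _) m,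
    Finset.sum_comm, map_sum]
  refine Finset.sum_congr rfl fun c _ => ?_
  rw [← Finset.mul_sum, map_mul, map_intCast, ← hu]
  rfl

end sums

end

section

variable {ℓ : ℕ} [Fact ℓ.Prime] {b r : ℕ}

section proj

/-- Reduction from level `n + 1` to level `n`. -/
def proj (n : ℕ) : (Fin b → ZMod (ℓ ^ (n + 1))) →+ (Fin b → ZMod (ℓ ^ n)) :=
  AddMonoidHom.compLeft
    (ZMod.castHom (pow_dvd_pow ℓ n.le_succ) (ZMod (ℓ ^ n))).toAddMonoidHom (Fin b)

theorem proj_red (n : ℕ) (v : Fin b → ℤ_[ℓ]) : proj n (red (n + 1) v) = red n v := by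
  ext i
  exact RingHom.congr_fun (PadicInt.zmod_cast_comp_toZModPow (p := ℓ) n (n + 1) n.le_succ) (v i)

theorem proj_surjective (n : ℕ) : Function.Surjective (proj (ℓ := ℓ) (b := b) n) := fun w => by
  obtain ⟨v, rfl⟩ := red_surjective n w
  exact ⟨_, proj_red n v⟩

theorem act_proj (Q : GL (Fin b) ℤ_[ℓ]) (n : ℕ) (m : ℤ) (w : Fin b → ZMod (ℓ ^ (n + 1))) :
    act Q m (proj n w) = proj n (act Q m w) := by
  obtain ⟨v, rfl⟩ := red_surjective _ w
  rw [proj_red, act_red, act_red, proj_red]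

theorem proj_mem_primFixed (hℓ : Odd ℓ) {Q : GL (Fin b) ℤ_[ℓ]}
    (hQ : Matrix.GeneralLinearGroup.map (PadicInt.toZMod (p := ℓ)) Q = 1) {n : ℕ} (hn : 0 < n)
    (m : ℤ) (w : Fin b → ZMod (ℓ ^ (n + 1))) :
    proj n w ∈ primFixed Q n m ↔ w ∈ primFixed Q (n + 1) (ℓ * m) := by
  obtain ⟨v, rfl⟩ := red_surjective _ w
  rw [mem_primFixed, mem_primFixed, proj_red, isPrimitive_red_iff hn,
    isPrimitive_red_iff n.succ_pos, act_prime_mul_eq_self_iff hℓ hQ]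

theorem card_fiber_proj (n : ℕ) (y : Fin b → ZMod (ℓ ^ n)) :
    (Finset.univ.filter fun w => proj n w = y).card = ℓ ^ b := by
  have h : ∀ y y' : Fin b → ZMod (ℓ ^ n), (Finset.univ.filter fun w => proj n w = y).card =
      (Finset.univ.filter fun w => proj n w = y').card := by
    intro y y'
    obtain ⟨d, hd⟩ := proj_surjective (ℓ := ℓ) n (y' - y)
    refine Finset.card_bij (fun w _ => w + d) ?_ (fun _ _ _ _ h => add_right_cancel h) ?_
    · intro w hw
      rw [Finset.mem_filter] at hw ⊢
      exact ⟨Finset.mem_univ _, by rw [map_add, hw.2, hd]; abel⟩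
    · intro w hw
      rw [Finset.mem_filter] at hw
      refine ⟨w - d, ?_, sub_add_cancel w d⟩
      rw [Finset.mem_filter]
      exact ⟨Finset.mem_univ _, by rw [map_sub, hw.2, hd]; abel⟩
  have hcard := Finset.card_eq_sum_card_fiberwise (s := Finset.univ) (t := Finset.univ)
    (f := proj (ℓ := ℓ) (b := b) n) (fun _ _ => Finset.mem_univ _)
  rw [Finset.sum_congr rfl fun y' _ => h y' y, Finset.sum_const, Finset.card_univ,
    Finset.card_univ, smul_eq_mul, Fintype.card_pi_const, Fintype.card_pi_const, ZMod.card,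
    ZMod.card, ← pow_mul, ← pow_mul, add_mul, one_mul, pow_add] at hcard
  exact (Nat.eq_of_mul_eq_mul_left (pow_pos (Fact.out : ℓ.Prime).pos _) hcard).symm

theorem sum_proj_primFixed (hℓ : Odd ℓ) {Q : GL (Fin b) ℤ_[ℓ]}
    (hQ : Matrix.GeneralLinearGroup.map (PadicInt.toZMod (p := ℓ)) Q = 1) {n : ℕ} (hn : 0 < n)
    (m : ℤ) (g : (Fin b → ZMod (ℓ ^ n)) → ℂ_[ℓ]) :
    ∑ w ∈ primFixed Q (n + 1) (ℓ * m), g (proj n w) = ℓ ^ b * ∑ w ∈ primFixed Q n m, g w := by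
  rw [Finset.mul_sum, ← Finset.sum_fiberwise_of_maps_to (t := primFixed Q n m) (g := proj n)
    (fun w hw => (proj_mem_primFixed hℓ hQ hn m w).2 hw)]
  refine Finset.sum_congr rfl fun y hy => ?_
  have h1 : (primFixed Q (n + 1) (ℓ * m)).filter (fun w => proj n w = y) =
      Finset.univ.filter fun w => proj n w = y := by
    ext w
    simp only [Finset.mem_filter, Finset.mem_univ, true_and, and_iff_right_iff_imp]
    rintro rfl
    exact (proj_mem_primFixed hℓ hQ hn m w).1 hy
  rw [h1, Finset.sum_congr rfl fun w hw => by rw [(Finset.mem_filter.1 hw).2], Finset.sum_const,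
    card_fiber_proj, nsmul_eq_mul, Nat.cast_pow]

end proj

section roots

variable (F : Matrix (Fin r) (Fin r) (MvPowerSeries (Fin b) ℤ_[ℓ]))

theorem evalAtRoot_congr {n n' : ℕ} {ζ ζ' : ℂ_[ℓ]} {w : Fin b → ZMod (ℓ ^ n)}
    {w' : Fin b → ZMod (ℓ ^ n')} (h : ∀ i, ζ ^ (w i).val = ζ' ^ (w' i).val) :
    evalAtRoot F ζ w = evalAtRoot F ζ' w' := by
  simp only [evalAtRoot, h]

theorem evalAtRoot_pow_proj {n : ℕ} {ζ : ℂ_[ℓ]} (hζ : ζ ^ ℓ ^ (n + 1) = 1)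
    (w : Fin b → ZMod (ℓ ^ (n + 1))) :
    evalAtRoot F (ζ ^ ℓ) (proj n w) = evalAtRoot F ζ (ℓ • w) := by
  refine evalAtRoot_congr F fun i => ?_
  have hζ' : (ζ ^ ℓ) ^ ℓ ^ n = 1 := by rw [← pow_mul, ← pow_succ', hζ]
  obtain ⟨k, hk⟩ : ∃ k : ℕ, (k : ZMod (ℓ ^ (n + 1))) = w i := ⟨(w i).val, ZMod.natCast_zmod_val _⟩
  have h1 : proj n w i = (k : ZMod (ℓ ^ n)) := by
    change ZMod.castHom (pow_dvd_pow ℓ n.le_succ) (ZMod (ℓ ^ n)) (w i) = _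
    rw [← hk, map_natCast]
  have h2 : (ℓ • w) i = ((ℓ * k : ℕ) : ZMod (ℓ ^ (n + 1))) := by
    rw [Pi.smul_apply, ← hk, nsmul_eq_mul, Nat.cast_mul]
  rw [← AddChar.zmodChar_apply hζ', ← AddChar.zmodChar_apply hζ, h1, h2, AddChar.zmodChar_apply',
    AddChar.zmodChar_apply', pow_mul]

theorem evalAtRoot_pow {n : ℕ} {ζ : ℂ_[ℓ]} (hζ : ζ ^ ℓ ^ n = 1) (k : ℕ)
    (w : Fin b → ZMod (ℓ ^ n)) : evalAtRoot F (ζ ^ k) w = evalAtRoot F ζ (k • w) := by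
  refine evalAtRoot_congr F fun i => ?_
  obtain ⟨j, hj⟩ : ∃ j : ℕ, (j : ZMod (ℓ ^ n)) = w i := ⟨(w i).val, ZMod.natCast_zmod_val _⟩
  have h2 : (k • w) i = ((k * j : ℕ) : ZMod (ℓ ^ n)) := by
    rw [Pi.smul_apply, ← hj, nsmul_eq_mul, Nat.cast_mul]
  rw [← AddChar.zmodChar_apply hζ, h2, AddChar.zmodChar_apply', pow_mul, ← pow_mul, ← pow_mul,
    mul_comm k, pow_mul, mul_comm k, pow_mul, ← AddChar.zmodChar_apply hζ (w i), ← hj,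
    AddChar.zmodChar_apply']

/-- The trace sums do not depend on the choice of the primitive root of unity. -/
theorem traceSum_eq_of_isPrimitiveRoot (Q : GL (Fin b) ℤ_[ℓ]) {n : ℕ} {ζ ζ' : ℂ_[ℓ]}
    (hζ : IsPrimitiveRoot ζ (ℓ ^ n)) (hζ' : IsPrimitiveRoot ζ' (ℓ ^ n)) (m : ℕ) :
    traceSum Q F n ζ' m = traceSum Q F n ζ m := by
  obtain ⟨k, _, hk, rfl⟩ := (hζ.isPrimitiveRoot_iff).1 hζ'
  set U := ZMod.unitOfCoprime k hk with hU
  have hsmul : ∀ w : Fin b → ZMod (ℓ ^ n), k • w = U • w := by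
    intro w
    ext i
    rw [Pi.smul_apply, Pi.smul_apply, nsmul_eq_mul, Units.smul_def, hU, ZMod.coe_unitOfCoprime,
      smul_eq_mul]
  have hmem : ∀ (V : (ZMod (ℓ ^ n))ˣ) (w : Fin b → ZMod (ℓ ^ n)), w ∈ primFixed Q n m →
      V • w ∈ primFixed Q n m := by
    intro V w hw
    rw [mem_primFixed] at hw ⊢
    obtain ⟨⟨i, hi⟩, h2⟩ := hw
    refine ⟨⟨i, ?_⟩, ?_⟩
    · rw [Pi.smul_apply, Units.smul_def, smul_eq_mul]
      exact V.isUnit.mul hi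
    · rw [act_smul, h2]
  refine Finset.sum_nbij' (fun w => U • w) (fun w => U⁻¹ • w) (hmem U) (hmem U⁻¹)
    (fun w _ => inv_smul_smul U w) (fun w _ => smul_inv_smul U w) fun w _ => ?_
  unfold matProd
  congr 3
  ext1 i
  rw [evalAtRoot_pow F hζ.pow_eq_one, hsmul, act_smul]

end roots

section unit

/-- A unit `U` commuting with `Q` such that `∑_{j<ℓ} Q^(-jm) = ℓ U`. -/
theorem exists_unit_sum_act (hℓ : Odd ℓ) {Q : GL (Fin b) ℤ_[ℓ]}
    (hQ : Matrix.GeneralLinearGroup.map (PadicInt.toZMod (p := ℓ)) Q = 1) (n : ℕ) (m : ℤ) :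
    ∃ U : GL (Fin b) ℤ_[ℓ],
      (∀ (k : ℤ) (w : Fin b → ZMod (ℓ ^ n)), act Q k (act U 1 w) = act U 1 (act Q k w)) ∧
      ∀ w : Fin b → ZMod (ℓ ^ n),
        ∑ j ∈ Finset.range ℓ, act Q (-(j * m)) w = ℓ • act U 1 w := by
  have hℓ0 : (ℓ : ℤ_[ℓ]) ≠ 0 := by exact_mod_cast (Fact.out : ℓ.Prime).ne_zero
  obtain ⟨M, hM⟩ := exists_eq_one_add_smul hQ (-m)
  obtain ⟨U, hU⟩ := exists_geom_sum_eq hℓ _ M hM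
  have hcomm : ∀ k : ℤ, Q ^ k * U = U * Q ^ k := by
    intro k
    apply Units.ext
    have h1 : (ℓ : ℤ_[ℓ]) • ((Q ^ k : GL (Fin b) ℤ_[ℓ]) * U : Matrix (Fin b) (Fin b) ℤ_[ℓ]) =
        (ℓ : ℤ_[ℓ]) • (U * (Q ^ k : GL (Fin b) ℤ_[ℓ]) : Matrix (Fin b) (Fin b) ℤ_[ℓ]) := by
      rw [← Matrix.mul_smul, ← Matrix.smul_mul, ← hU, Finset.mul_sum, Finset.sum_mul]
      refine Finset.sum_congr rfl fun j _ => ?_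
      rw [← Units.val_pow_eq_pow_val, ← Units.val_mul, ← Units.val_mul, ← zpow_natCast, ← zpow_mul,
        ← zpow_add, ← zpow_add, add_comm]
    ext p q
    exact mul_left_cancel₀ hℓ0 (congrFun (congrFun h1 p) q)
  refine ⟨U, fun k w => ?_, fun w => ?_⟩
  · obtain ⟨v, rfl⟩ := red_surjective _ w
    rw [act_red, act_red, act_red, act_red, Matrix.mulVec_mulVec, Matrix.mulVec_mulVec, zpow_one,
      ← Units.val_mul, ← Units.val_mul, hcomm]
  · obtain ⟨v, rfl⟩ := red_surjective _ w
    have h1 : ∀ j : ℕ, act Q (-(j * m)) (red n v) =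
        red n ((((Q ^ (-m) : GL (Fin b) ℤ_[ℓ]) : Matrix (Fin b) (Fin b) ℤ_[ℓ]) ^ j).mulVec v) := by
      intro j
      rw [act_red, ← coe_zpow_natCast_mul, mul_neg]
    have h2 : ∀ (s : Finset ℕ) (g : ℕ → Fin b → ℤ_[ℓ]),
        ∑ j ∈ s, red n (g j) = red n (∑ j ∈ s, g j) := by
      intro s g
      ext i
      simp [red, Finset.sum_apply]
    rw [Finset.sum_congr rfl fun j _ => h1 j, h2, ← Matrix.sum_mulVec, hU, act_red, zpow_one,
      Matrix.smul_mulVec, red_smul, map_natCast]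
    ext i
    simp

end unit

end

section

variable {ℓ : ℕ} [Fact ℓ.Prime] {b r : ℕ}

theorem phase_mul_of_periodic (Q : GL (Fin b) ℤ_[ℓ]) {n m : ℕ} {x : ℕ → Fin b → ZMod (ℓ ^ n)}
    (hx : ∀ i, x (i + m) = x i) (k : ℕ) (w : Fin b → ZMod (ℓ ^ n)) :
    phase Q (m * k) x w = phase Q m x (∑ j ∈ Finset.range k, act Q (-(j * m)) w) := by
  have hx' : ∀ k i, x (m * k + i) = x i := by
    intro k i
    induction k with
    | zero => simp
    | succ k ih => rw [← ih, ← hx (m * k + i)]; congr 1; ring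
  induction k with
  | zero => simp [phase_apply, act]
  | succ k ih =>
    rw [Finset.sum_range_succ, map_add, ← ih, phase_apply, phase_apply, phase_apply, mul_add,
      mul_one, Finset.sum_range_add]
    congr 1
    refine Finset.sum_congr rfl fun i _ => ?_
    rw [hx', act_act]
    congr 2
    push_cast
    ring

theorem phase_shift (Q : GL (Fin b) ℤ_[ℓ]) {n d : ℕ} {x : ℕ → Fin b → ZMod (ℓ ^ n)}
    (hx : ∀ i, x (i + d) = x i) {w : Fin b → ZMod (ℓ ^ n)} (hw : act Q d w = w) :
    phase Q d (fun i => x (i + 1)) w = phase Q d x (act Q 1 w) := by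
  have h := sum_range_succ_of_periodic
    (fun i => x i ⬝ᵥ act Q (-((i : ℤ) + 1)) (act Q 1 w)) d ?_
  · rw [phase_apply, phase_apply]
    refine Eq.trans (Finset.sum_congr rfl fun i _ => ?_) h
    rw [act_act, show -(((i + 1 : ℕ) : ℤ) + 1) + 1 = -((i : ℤ) + 1) by push_cast; ring]
  · have h1 : act Q (-((d : ℤ) + 1)) (act Q 1 w) = w := by
      rw [act_act, show -((d : ℤ) + 1) + 1 = -d by ring, act_neg_eq_self Q hw]
    have h2 : act Q (-(((0 : ℕ) : ℤ) + 1)) (act Q 1 w) = w := by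
      rw [act_act]
      exact act_zero Q w
    rw [h1, h2, ← hx 0, zero_add]

theorem sum_addChar_phase_of_periodic (hℓ : Odd ℓ) {Q : GL (Fin b) ℤ_[ℓ]}
    (hQ : Matrix.GeneralLinearGroup.map (PadicInt.toZMod (p := ℓ)) Q = 1) {n m : ℕ}
    (ψ : AddChar (ZMod (ℓ ^ n)) ℂ_[ℓ]) {x : ℕ → Fin b → ZMod (ℓ ^ n)}
    (hx : ∀ i, x (i + m) = x i) (M : ℤ) :
    ∑ w ∈ primFixed Q n M, ψ (phase Q (ℓ * m) x w) =
      ∑ w ∈ primFixed Q n M, ψ (phase Q m x (ℓ • w)) := by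
  obtain ⟨U, hU, hsum⟩ := exists_unit_sum_act hℓ hQ n m
  refine Finset.sum_bij (fun w _ => act U 1 w) ?_ ?_ ?_ ?_
  · intro w hw
    rw [mem_primFixed] at hw ⊢
    exact ⟨(isPrimitive_act U).2 hw.1, by rw [hU, hw.2]⟩
  · intro w _ w' _ h
    exact (actPerm U n).injective h
  · intro w hw
    rw [mem_primFixed] at hw
    refine ⟨act U (-1) w, ?_, ?_⟩
    · rw [mem_primFixed]
      refine ⟨(isPrimitive_act U).2 hw.1, (actPerm U n).injective ?_⟩
      rw [actPerm_apply, ← hU, actPerm_apply, act_act, add_neg_cancel, act_zero, hw.2]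
    · rw [act_act, add_neg_cancel, act_zero]
  · intro w _
    rw [mul_comm, phase_mul_of_periodic Q hx, hsum]

section comparison

variable (F : Matrix (Fin r) (Fin r) (MvPowerSeries (Fin b) ℤ_[ℓ]))

theorem matProd_proj (Q : GL (Fin b) ℤ_[ℓ]) {n : ℕ} {ζ : ℂ_[ℓ]} (hζ : ζ ^ ℓ ^ (n + 1) = 1) (m : ℕ)
    (w : Fin b → ZMod (ℓ ^ (n + 1))) :
    matProd Q F (ζ ^ ℓ) m (proj n w) =
      ((List.range m).map fun i : ℕ => evalAtRoot F ζ (ℓ • act Q (-((i : ℤ) + 1)) w)).prod := by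
  simp only [matProd, act_proj, evalAtRoot_pow_proj F hζ]

theorem exists_traceSum_sub_eq (hℓ : Odd ℓ) {Q : GL (Fin b) ℤ_[ℓ]}
    (hQ : Matrix.GeneralLinearGroup.map (PadicInt.toZMod (p := ℓ)) Q = 1) {n : ℕ} (hn : 0 < n)
    {ζ : ℂ_[ℓ]} (hζ : ζ ^ ℓ ^ (n + 1) = 1) {m : ℕ} (hm : 0 < m) {D : ℕ}
    (hD : D ∣ Nat.card (nonprimFixed Q (n + 1) ((ℓ * m : ℕ) : ℤ))) {s : ℕ} (hs : ℓ ^ s ∣ m) :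
    ∃ z : ℤ_[ℓ], traceSum Q F (n + 1) ζ (ℓ * m) - ℓ ^ b * traceSum Q F n (ζ ^ ℓ) m =
      ofPadicInt ℓ z ∧ (ℓ : ℤ_[ℓ]) ^ (s + 1) * D ∣ z := by
  classical
  have hp : ℓ.Prime := Fact.out
  have : NeZero m := ⟨hm.ne'⟩
  have : NeZero (ℓ * m) := ⟨(Nat.mul_pos hp.pos hm).ne'⟩
  obtain ⟨f, hf⟩ := exists_fourier_matrix F hζ
  set ψ := AddChar.zmodChar (ℓ ^ (n + 1)) hζ
  set W := primFixed Q (n + 1) ((ℓ * m : ℕ) : ℤ) with hW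
  choose u hu hDu using fun c : ZMod (ℓ * m) → Fin r × (Fin b → ZMod (ℓ ^ (n + 1))) =>
    exists_int_sum_primFixed Q n.succ_pos ((ℓ * m : ℕ) : ℤ)
      (ψ.compAddMonoidHom (phase Q (ℓ * m) fun i => (unroll c i).2))
  have hu' : ∀ c : ZMod (ℓ * m) → Fin r × (Fin b → ZMod (ℓ ^ (n + 1))),
      ∑ w ∈ W, ψ (phase Q (ℓ * m) (fun i => (unroll c i).2) w) = u c := hu
  let per : (ZMod (ℓ * m) → Fin r × (Fin b → ZMod (ℓ ^ (n + 1)))) → Prop := fun c => (rot (ℓ * m) _ ^ m) c = c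
  let h : (ZMod (ℓ * m) → Fin r × (Fin b → ZMod (ℓ ^ (n + 1)))) → ℤ_[ℓ] := fun c =>
    u c * (wt f (ℓ * m) (unroll c) - if per c then wt f m (unroll c) else 0)
  have hlevel : traceSum Q F (n + 1) ζ (ℓ * m) =
      ∑ c : ZMod (ℓ * m) → Fin r × (Fin b → ZMod (ℓ ^ (n + 1))), ofPadicInt ℓ (u c * wt f (ℓ * m) (unroll c)) := by
    simp only [traceSum, matProd]
    rw [Finset.sum_congr rfl fun w _ =>
      trace_list_prod_char ψ f _ _ (fun i => hf _) (ℓ * m), Finset.sum_comm]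
    refine Finset.sum_congr rfl fun c _ => ?_
    rw [← Finset.mul_sum, map_mul, map_intCast, ← hu', mul_comm]
    rfl
  have hlevel' : ℓ ^ b * traceSum Q F n (ζ ^ ℓ) m =
      ∑ c : ZMod (ℓ * m) → Fin r × (Fin b → ZMod (ℓ ^ (n + 1))), ofPadicInt ℓ (u c * if per c then wt f m (unroll c) else 0) := by
    rw [traceSum, ← sum_proj_primFixed hℓ hQ hn, ← Nat.cast_mul, ← hW]
    simp only [matProd_proj F Q hζ]
    rw [Finset.sum_congr rfl fun w _ =>
      trace_list_prod_char ψ f _ _ (fun i => hf _) m, Finset.sum_comm]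
    simp only [← Finset.mul_sum]
    rw [sum_unroll_eq_sum_periodic (k := ℓ) (fun c : ℕ → Fin r × (Fin b → ZMod (ℓ ^ (n + 1))) => ofPadicInt ℓ (wt f m c) *
      ∑ w ∈ W, ψ (∑ i ∈ Finset.range m, (c i).2 ⬝ᵥ ℓ • act Q (-((i : ℤ) + 1)) w))]
    refine Finset.sum_congr rfl fun c _ => ?_
    change (if per c then _ else _) = _
    split_ifs with hc
    · rw [map_mul, map_intCast, ← hu', mul_comm]
      congr 1
      rw [hW, sum_addChar_phase_of_periodic hℓ hQ ψ
        (fun i => congrArg Prod.snd (unroll_add_of_rot_pow hc i))]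
      simp only [phase_apply, act_smul]
    · simp
  have hrotu : ∀ c, u (rot (ℓ * m) _ c) = u c := by
    intro c
    apply Int.cast_injective (α := ℂ_[ℓ])
    rw [← hu', ← hu', unroll_rot]
    refine Finset.sum_bij (fun w _ => act Q 1 w) (fun w hw => (act_mem_primFixed 1).2 hw)
      (fun w _ w' _ h => (actPerm Q (n + 1)).injective h) (fun w hw => ?_) fun w hw => ?_
    · exact ⟨act Q (-1) w, (act_mem_primFixed (-1)).2 hw, by
        rw [act_act, add_neg_cancel, act_zero]⟩
    · exact congrArg ψ (phase_shift Q (x := fun i => (unroll c i).2)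
        (fun i => congrArg Prod.snd (unroll_periodic c i)) (mem_primFixed.1 hw).2)
  have hrot : ∀ c, h (rot (ℓ * m) _ c) = h c := by
    intro c
    have hper : per (rot (ℓ * m) _ c) ↔ per c := by
      change (rot (ℓ * m) _ ^ m) (rot (ℓ * m) _ c) = rot (ℓ * m) _ c ↔ _
      rw [← Equiv.Perm.mul_apply, ← pow_succ, pow_succ' _ m, Equiv.Perm.mul_apply]
      exact (rot (ℓ * m) _).injective.eq_iff
    simp only [h, hrotu, hper, unroll_rot, wt_shift f (unroll_periodic c)]
    split_ifs with hc
    · rw [wt_shift f (unroll_add_of_rot_pow hc)]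
    · rfl
  have hrotk : ∀ k c, h ((rot (ℓ * m) _ ^ k) c) = h c := by
    intro k c
    induction k with
    | zero => rfl
    | succ k ih => rw [pow_succ' _ k, Equiv.Perm.mul_apply, hrot, ih]
  refine ⟨∑ c, h c, ?_, ?_⟩
  · rw [hlevel, hlevel', ← Finset.sum_sub_distrib, map_sum]
    refine Finset.sum_congr rfl fun c _ => ?_
    rw [← map_sub, ← mul_sub]
  · obtain ⟨m', hm'⟩ := hs
    have hpow : ∀ k c, ((rot (ℓ * m) (Fin r × (Fin b → ZMod (ℓ ^ (n + 1)))) ^ m') ^ k) c =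
        (rot (ℓ * m) _ ^ (m' * k)) c := by
      intro k c
      rw [← pow_mul]
    refine pow_mul_dvd_sum_of_perm hp (rot _ _ ^ m') (s + 1) ?_ h (hrotk m') D ?_
    · ext1 c
      rw [hpow]
      ext1 i
      rw [rot_pow_apply, show m' * ℓ ^ (s + 1) = ℓ * m by rw [hm']; ring]
      simp
    · intro c e he hc
      have hDc : (D : ℤ_[ℓ]) ∣ (u c : ℤ_[ℓ]) := by
        obtain ⟨y, hy⟩ := (Int.natCast_dvd_natCast.2 hD).trans (hDu c)
        exact ⟨y, by rw [hy]; push_cast; ring⟩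
      rw [mul_comm _ (D : ℤ_[ℓ])]
      refine mul_dvd_mul hDc ?_
      rcases he.lt_or_eq with he | rfl
      · obtain ⟨a, rfl⟩ := Nat.exists_eq_add_of_le (Nat.lt_succ_iff.1 he)
        rw [hpow] at hc
        have hun := unroll_add_of_rot_pow hc
        have hperc : per c := by
          change (rot (ℓ * m) _ ^ m) c = c
          have h2 : (rot (ℓ * m) (Fin r × (Fin b → ZMod (ℓ ^ (n + 1)))) ^ m) =
              (rot (ℓ * m) _ ^ (m' * ℓ ^ e)) ^ ℓ ^ a := by
            rw [← pow_mul]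
            congr 1
            rw [hm']
            ring
          rw [h2, ← Equiv.Perm.iterate_eq_pow]
          exact Function.IsFixedPt.iterate hc (ℓ ^ a)
        have h3 := wt_mul_of_periodic f hun (ℓ ^ (a + 1))
        have h4 := wt_mul_of_periodic f hun (ℓ ^ a)
        rw [show m' * ℓ ^ e * ℓ ^ (a + 1) = ℓ * m by rw [hm']; ring] at h3
        rw [show m' * ℓ ^ e * ℓ ^ a = m by rw [hm']; ring] at h4
        rw [if_pos hperc, show e + a + 1 - e = a + 1 by omega, h3, h4]
        exact pow_dvd_pow_prime_pow_sub _ a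
      · simp

end comparison

end

section

variable {ℓ : ℕ} [Fact ℓ.Prime] {b r : ℕ}

section integrality

/-- The closed unit ball of `ℂ_ℓ`. -/
def unitBall (ℓ : ℕ) [Fact ℓ.Prime] : Subring ℂ_[ℓ] where
  carrier := {x | ‖x‖ ≤ 1}
  zero_mem' := by simp
  one_mem' := by simp
  add_mem' hx hy := (IsUltrametricDist.norm_add_le_max _ _).trans (max_le hx hy)
  neg_mem' hx := (norm_neg _).trans_le hx
  mul_mem' hx hy := (norm_mul_le _ _).trans (mul_le_one₀ hx (norm_nonneg _) hy)

variable (Q : GL (Fin b) ℤ_[ℓ]) (F : Matrix (Fin r) (Fin r) (MvPowerSeries (Fin b) ℤ_[ℓ]))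

theorem evalAtRoot_mem_unitBall {n : ℕ} {ζ : ℂ_[ℓ]} (hζ : ζ ^ ℓ ^ n = 1)
    (w : Fin b → ZMod (ℓ ^ n)) (p q : Fin r) : evalAtRoot F ζ w p q ∈ unitBall ℓ := by
  obtain ⟨f, hf⟩ := exists_fourier_matrix F hζ
  rw [hf]
  refine sum_mem fun x _ => mul_mem (norm_ofPadicInt_le_one _) ?_
  rw [AddChar.zmodChar_apply]
  refine pow_mem (le_of_eq ?_ : ‖ζ‖ ≤ 1) _
  rw [← pow_eq_one_iff_of_nonneg (norm_nonneg ζ) (pow_pos (Fact.out : ℓ.Prime).pos n).ne',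
    ← norm_pow, hζ, norm_one]

theorem coeff_polyR_mem_unitBall {n : ℕ} {ζ : ℂ_[ℓ]} (hζ : ζ ^ ℓ ^ n = 1)
    (S : Finset (Fin b → ZMod (ℓ ^ n))) (i : ℕ) :
    (polyR Q F ζ S).coeff i ∈ unitBall ℓ := by
  let E : (Fin b → ZMod (ℓ ^ n)) → Matrix (Fin r) (Fin r) (unitBall ℓ) := fun w =>
    Matrix.of fun p q => ⟨evalAtRoot F ζ w p q, evalAtRoot_mem_unitBall F hζ w p q⟩
  have hA : ∀ w : Fin b → ZMod (ℓ ^ n), ∃ A : Matrix (Fin r) (Fin r) (unitBall ℓ),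
      matA Q F ζ w = (unitBall ℓ).subtype.mapMatrix A := by
    intro w
    refine ⟨((List.range (orbitSize Q w)).map fun i : ℕ => E (act Q (-((i : ℤ) + 1)) w)).prod, ?_⟩
    rw [matA_eq_matProd, matProd, map_list_prod, List.map_map]
    rfl
  choose A hA using hA
  have hP : ∀ w : Fin b → ZMod (ℓ ^ n), polyP Q F ζ w = ((1 - (Polynomial.X : (unitBall ℓ)[X]) •
      (A w).map Polynomial.C).det).map (unitBall ℓ).subtype := by
    intro w
    rw [polyP, hA, ← Polynomial.coe_mapRingHom, RingHom.map_det]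
    congr 1
    ext1 p q
    by_cases hpq : p = q <;> simp [hpq]
  have hR : polyR Q F ζ S = (∏ v ∈ S, (1 - (Polynomial.X : (unitBall ℓ)[X]) •
      (A v).map Polynomial.C).det.comp
        (Polynomial.X ^ (orbitSize Q v / minOrbitSize Q n))).map (unitBall ℓ).subtype := by
    simp only [polyR, hP, Polynomial.map_prod, Polynomial.map_comp, Polynomial.map_pow,
      Polynomial.map_X]
  rw [hR, Polynomial.coeff_map]
  exact Subtype.coe_prop _

theorem exists_map_eq_of_hasLogDeriv {P : ℂ_[ℓ][X]} {t : ℕ → ℂ_[ℓ]}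
    (hP : HasLogDeriv (P : PowerSeries ℂ_[ℓ]) t)
    (ht : ∀ j, 0 < j → t j ∈ (algebraMap ℚ_[ℓ] ℂ_[ℓ]).range)
    (hint : ∀ i, P.coeff i ∈ unitBall ℓ) :
    ∃ R : ℤ_[ℓ][X], R.map (ofPadicInt ℓ) = P := by
  have hrat : ∀ i, P.coeff i ∈ (algebraMap ℚ_[ℓ] ℂ_[ℓ]).range := by
    intro i
    induction i using Nat.strong_induction_on with
    | _ i ih =>
      rcases i with _ | i
      · have := hP.1
        rw [← PowerSeries.coeff_zero_eq_constantCoeff_apply, Polynomial.coeff_coe] at this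
        rw [this]
        exact one_mem _
      · have h := hP.coeff_succ i
        rw [Polynomial.coeff_coe] at h
        have h1 : P.coeff (i + 1) * ((i + 1 : ℕ) : ℂ_[ℓ]) ∈ (algebraMap ℚ_[ℓ] ℂ_[ℓ]).range := by
          rw [h]
          refine neg_mem (sum_mem fun p hp => ?_)
          rw [Polynomial.coeff_coe]
          have := Finset.HasAntidiagonal.mem_antidiagonal.1 hp
          exact mul_mem (ih _ (by omega)) (ht _ (Nat.succ_pos _))
        obtain ⟨x, hx⟩ := h1
        have hne : ((i + 1 : ℕ) : ℂ_[ℓ]) ≠ 0 := Nat.cast_ne_zero.2 i.succ_ne_zero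
        refine ⟨x / (i + 1 : ℕ), ?_⟩
        rw [map_div₀, hx, map_natCast, mul_div_cancel_right₀ _ hne]
  have hmem : ∀ i, P.coeff i ∈ Set.range (ofPadicInt ℓ) := by
    intro i
    obtain ⟨x, hx⟩ := hrat i
    have h1 : ‖P.coeff i‖ ≤ 1 := hint i
    rw [← hx, norm_algebraMap'] at h1
    exact ⟨⟨x, h1⟩, hx⟩
  exact (Polynomial.mem_lifts P).1 ((Polynomial.lifts_iff_coeff_lifts P).2 hmem)

end integrality

section card

theorem smul_prime_eq_iff (n : ℕ) (u u' : Fin b → ZMod (ℓ ^ (n + 1))) :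
    ℓ • u = ℓ • u' ↔ proj n u = proj n u' := by
  obtain ⟨v, rfl⟩ := red_surjective _ u
  obtain ⟨v', rfl⟩ := red_surjective _ u'
  have h : ∀ v : Fin b → ℤ_[ℓ], ℓ • red (n + 1) v = red (n + 1) ((ℓ : ℤ_[ℓ]) • v) := by
    intro v
    rw [red_smul, map_natCast]
    ext i
    simp
  have hℓ0 : (ℓ : ℤ_[ℓ]) ≠ 0 := by exact_mod_cast (Fact.out : ℓ.Prime).ne_zero
  rw [proj_red, proj_red, h, h, red_eq_red_iff, red_eq_red_iff, ← smul_sub]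
  refine exists_congr fun x => ?_
  rw [pow_succ', mul_smul]
  exact ⟨fun h => smul_vec_right_injective hℓ0 h, fun h => by rw [h]⟩

theorem pow_dvd_card_nonprimFixed (Q : GL (Fin b) ℤ_[ℓ]) {n : ℕ} (hn : 0 < n) {M : ℤ}
    {w : Fin b → ZMod (ℓ ^ (n + 1))} (hw : IsPrimitive w) (hfix : act Q M w = w) :
    ℓ ^ n ∣ Nat.card (nonprimFixed Q (n + 1) M) := by
  obtain ⟨n, rfl⟩ := Nat.exists_eq_succ_of_ne_zero hn.ne'
  have hzero : ∀ k : ℕ, k = ℓ ^ (n + 1 + 1) → k • w = 0 := by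
    rintro k rfl
    ext i
    rw [Pi.smul_apply, nsmul_eq_mul, ZMod.natCast_self, zero_mul]
    rfl
  have hord : addOrderOf (ℓ • w) = ℓ ^ (n + 1) := by
    apply addOrderOf_eq_prime_pow
    · rw [smul_smul, ← pow_succ]
      intro h
      obtain ⟨i, hi⟩ := hw
      have h1 := congrFun h i
      rw [Pi.smul_apply, nsmul_eq_mul, Pi.zero_apply, hi.mul_left_eq_zero,
        ZMod.natCast_eq_zero_iff] at h1
      exact absurd ((Nat.pow_dvd_pow_iff_le_right (Fact.out : ℓ.Prime).one_lt).1 h1) (by omega)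
    · rw [smul_smul, ← pow_succ]
      exact hzero _ rfl
  have hmem : ℓ • w ∈ nonprimFixed Q (n + 1 + 1) M := ⟨by rw [act_smul, hfix], w, rfl⟩
  rw [Nat.succ_eq_add_one, ← hord]
  exact AddSubgroup.addOrderOf_dvd_natCard _ hmem

theorem pow_mul_dvd_card_nonprimFixed (Q : GL (Fin b) ℤ_[ℓ]) (n : ℕ) {M : ℤ}
    (hfix : ∀ w : Fin b → ZMod (ℓ ^ (n + 1)), act Q M w = w) :
    ℓ ^ (n * b) ∣ Nat.card (nonprimFixed Q (n + 1) M) := by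
  obtain ⟨g, hg⟩ := (proj_surjective (ℓ := ℓ) (b := b) n).hasRightInverse
  let φ : (Fin b → ZMod (ℓ ^ n)) → nonprimFixed Q (n + 1) M := fun y =>
    ⟨ℓ • g y, hfix _, g y, rfl⟩
  have hφ : Function.Bijective φ := by
    constructor
    · intro y y' h
      have h1 := (smul_prime_eq_iff n _ _).1 (congrArg Subtype.val h)
      rwa [hg, hg] at h1
    · rintro ⟨_, _, u, rfl⟩
      refine ⟨proj n u, Subtype.ext ((smul_prime_eq_iff n _ _).2 ?_)⟩
      rw [hg]
  rw [← Nat.card_eq_of_bijective φ hφ, Nat.card_eq_fintype_card, Fintype.card_pi_const, ZMod.card,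
    ← pow_mul]

theorem act_eq_self_of_scalar {Q : GL (Fin b) ℤ_[ℓ]} {q : ℤ_[ℓ]}
    (hq : (Q : Matrix (Fin b) (Fin b) ℤ_[ℓ]) = q • 1) {n : ℕ} (m : ℕ)
    {w : Fin b → ZMod (ℓ ^ n)} (hw : IsPrimitive w) (hfix : act Q m w = w)
    (y : Fin b → ZMod (ℓ ^ n)) : act Q m y = y := by
  have hact : ∀ y : Fin b → ZMod (ℓ ^ n), act Q m y = PadicInt.toZModPow n (q ^ m) • y := by
    intro y
    obtain ⟨v, rfl⟩ := red_surjective n y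
    rw [act_red, zpow_natCast, Units.val_pow_eq_pow_val, hq, smul_pow, one_pow,
      Matrix.smul_mulVec, Matrix.one_mulVec, red_smul]
  obtain ⟨i, hi⟩ := hw
  rw [hact] at hfix
  have h1 : PadicInt.toZModPow n (q ^ m) = 1 := by
    apply hi.mul_right_cancel
    rw [one_mul]
    exact congrFun hfix i
  rw [hact, h1, one_smul]

end card

section congruence

theorem prime_pow_dvd_sub_of_traceSum (hb : 0 < b) (hℓ : Odd ℓ) {Q : GL (Fin b) ℤ_[ℓ]}
    (hQ : Matrix.GeneralLinearGroup.map (PadicInt.toZMod (p := ℓ)) Q = 1)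
    (F : Matrix (Fin r) (Fin r) (MvPowerSeries (Fin b) ℤ_[ℓ])) {n e K : ℕ} (hn : 0 < n)
    (hK : 0 < K) {ζ ζ' : ℂ_[ℓ]} (hζ : IsPrimitiveRoot ζ (ℓ ^ n))
    (hζ' : IsPrimitiveRoot ζ' (ℓ ^ (n + 1)))
    (hD : ∀ j, 0 < j → ℓ ^ K ∣ Nat.card (nonprimFixed Q (n + 1) ((ℓ * (j * ℓ ^ e) : ℕ) : ℤ)))
    {R R' : ℤ_[ℓ][X]} {t t' : ℕ → ℂ_[ℓ]}
    (hR : HasLogDeriv (R.map (ofPadicInt ℓ) : PowerSeries ℂ_[ℓ]) t)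
    (hR' : HasLogDeriv (R'.map (ofPadicInt ℓ) : PowerSeries ℂ_[ℓ]) t')
    (ht : ∀ j, ((ℓ ^ e : ℕ) : ℂ_[ℓ]) * t j = traceSum Q F n ζ (j * ℓ ^ e))
    (ht' : ∀ j, ((ℓ ^ (e + 1) : ℕ) : ℂ_[ℓ]) * t' j =
      traceSum Q F (n + 1) ζ' (j * ℓ ^ (e + 1))) :
    Polynomial.C ((ℓ : ℤ_[ℓ]) ^ K) ∣ R' - R ^ ℓ ^ (b - 1) := by
  have hp : ℓ.Prime := Fact.out
  have hcoe : ∀ P : ℤ_[ℓ][X], ((P.map (ofPadicInt ℓ) : ℂ_[ℓ][X]) : PowerSeries ℂ_[ℓ]) =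
      (P : PowerSeries ℤ_[ℓ]).map (ofPadicInt ℓ) := fun P => by
    ext i
    simp
  rw [hcoe] at hR hR'
  set U : PowerSeries ℤ_[ℓ] := (R : PowerSeries ℤ_[ℓ]) ^ ℓ ^ (b - 1) with hU
  have hUlog : HasLogDeriv (U.map (ofPadicInt ℓ)) (ℓ ^ (b - 1) • t) := by
    rw [hU, map_pow]
    exact hR.pow _
  have hUu : IsUnit U := by
    rw [PowerSeries.isUnit_iff_constantCoeff]
    have h := hUlog.1
    rw [← PowerSeries.coeff_zero_eq_constantCoeff_apply, PowerSeries.coeff_map,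
      ← map_one (ofPadicInt ℓ)] at h
    rw [← PowerSeries.coeff_zero_eq_constantCoeff_apply, ofPadicInt_injective h]
    exact isUnit_one
  obtain ⟨g, hg⟩ : U ∣ (R' : PowerSeries ℤ_[ℓ]) := hUu.dvd
  rw [hg, map_mul] at hR'
  have hglog := hR'.of_mul hUlog
  have hy : ∀ j, 0 < j → ∃ y : ℤ_[ℓ], (t' - ℓ ^ (b - 1) • t) j = ofPadicInt ℓ y ∧
      (ℓ : ℤ_[ℓ]) ^ K * (j : ℕ) ∣ y := by
    intro j hj
    obtain ⟨v, j', hj', rfl⟩ := Nat.exists_eq_pow_mul_and_not_dvd hj.ne' ℓ hp.ne_one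
    have hu : IsUnit (j' : ℤ_[ℓ]) := by
      rw [PadicInt.isUnit_iff, PadicInt.norm_natCast_eq_one_iff]
      exact (hp.coprime_iff_not_dvd).2 hj'
    have hs : ℓ ^ (v + e) ∣ ℓ ^ v * j' * ℓ ^ e := ⟨j', by ring⟩
    obtain ⟨z, hz, hzd⟩ := exists_traceSum_sub_eq F hℓ hQ hn hζ'.pow_eq_one
      (Nat.mul_pos hj (pow_pos hp.pos e)) (hD _ hj) hs
    have hζpow : IsPrimitiveRoot (ζ' ^ ℓ) (ℓ ^ n) :=
      hζ'.pow (pow_pos hp.pos _) (pow_succ' ℓ n)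
    rw [traceSum_eq_of_isPrimitiveRoot F Q hζ hζpow, ← ht,
      show ℓ * (ℓ ^ v * j' * ℓ ^ e) = ℓ ^ v * j' * ℓ ^ (e + 1) by ring, ← ht'] at hz
    obtain ⟨z', rfl⟩ := hzd
    refine ⟨(ℓ : ℤ_[ℓ]) ^ v * (ℓ : ℤ_[ℓ]) ^ K * z', ?_, ?_⟩
    · have hne : ((ℓ : ℂ_[ℓ]) ^ (e + 1)) ≠ 0 := pow_ne_zero _ (Nat.cast_ne_zero.2 hp.ne_zero)
      apply mul_left_cancel₀ hne
      rw [Pi.sub_apply, Pi.smul_apply, nsmul_eq_mul]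
      obtain ⟨b, rfl⟩ := Nat.exists_eq_succ_of_ne_zero hb.ne'
      simp only [Nat.succ_eq_add_one,
        Nat.add_sub_cancel, map_mul, map_pow, map_natCast, Nat.cast_pow] at hz ⊢
      rw [← sub_eq_zero] at hz ⊢
      rw [← hz]
      ring
    · rw [Nat.cast_mul, Nat.cast_pow, ← mul_assoc, hu.mul_right_dvd, mul_comm _ ((ℓ : ℤ_[ℓ]) ^ v)]
      exact dvd_mul_right _ _
  choose! y hy1 hy2 using hy
  have hglog' : HasLogDeriv g y :=
    (HasLogDeriv.map (ofPadicInt ℓ) ofPadicInt_injective).1 (hglog.congr hy1)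
  have hgdvd : ∀ i, (ℓ : ℤ_[ℓ]) ^ K ∣ PowerSeries.coeff i (g - 1) := by
    intro i
    rcases Nat.eq_zero_or_pos i with rfl | hi
    · rw [map_sub, PowerSeries.coeff_zero_eq_constantCoeff_apply, hglog'.1]
      simp
    · rw [map_sub, PowerSeries.coeff_one, if_neg hi.ne', sub_zero]
      exact hglog'.pow_dvd_coeff hK hy2 hi
  rw [Polynomial.C_dvd_iff_dvd_coeff]
  intro i
  have hi : (R' - R ^ ℓ ^ (b - 1)).coeff i = PowerSeries.coeff i (U * (g - 1)) := by
    rw [mul_sub, ← hg, mul_one, hU, ← Polynomial.coe_pow, ← Polynomial.coe_sub,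
      Polynomial.coeff_coe]
  rw [hi, PowerSeries.coeff_mul]
  exact Finset.dvd_sum fun p _ => (hgdvd _).mul_left _

end congruence

end

end SkewIwasawa

end

theorem mainTheorem2 (ℓ : ℕ) [Fact ℓ.Prime] (hℓ : Odd ℓ) (b r : ℕ) (hb : 0 < b)
    (Q : GL (Fin b) ℤ_[ℓ])
    (hQ : Matrix.GeneralLinearGroup.map (PadicInt.toZMod (p := ℓ)) Q = 1)
    (hfix : ∀ v : Fin b → ℤ_[ℓ], Matrix.mulVec (Q : Matrix (Fin b) (Fin b) ℤ_[ℓ]) v = v → v = 0)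
    (F : Matrix (Fin r) (Fin r) (MvPowerSeries (Fin b) ℤ_[ℓ]))
    (ζ : ℕ → ℂ_[ℓ]) (hζ : ∀ n, IsPrimitiveRoot (ζ n) (ℓ ^ n))
    (S : ∀ n : ℕ, Finset (Fin b → ZMod (ℓ ^ n))) (hS : ∀ n, SkewIwasawa.IsOrbitReps Q (S n)) :
    ∃ R : ℕ → ℤ_[ℓ][X],
      (∀ n, (R n).map (SkewIwasawa.ofPadicInt ℓ) = SkewIwasawa.polyR Q F (ζ n) (S n)) ∧
      ∃ n₀ : ℕ,
        (∀ n, SkewIwasawa.minOrbitSize Q n = ℓ ^ (n - n₀)) ∧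
        (∀ n, n₀ ≤ n →
          Polynomial.C ((ℓ : ℤ_[ℓ]) ^ n) ∣ R (n + 1) - R n ^ ℓ ^ (b - 1)) ∧
        ((∃ q : ℤ_[ℓ], (Q : Matrix (Fin b) (Fin b) ℤ_[ℓ]) = q • 1) →
          ∀ n, n₀ ≤ n →
            Polynomial.C ((ℓ : ℤ_[ℓ]) ^ (n * b)) ∣ R (n + 1) - R n ^ ℓ ^ (b - 1)) := by
  obtain ⟨n₀, hn₀, ⟨v₀, hv₀, hv₀fix⟩, hmax⟩ := SkewIwasawa.exists_max_fixed hb hQ hfix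
  have hk : ∀ n, SkewIwasawa.minOrbitSize Q n = ℓ ^ (n - n₀) := fun n =>
    SkewIwasawa.minOrbitSize_eq hℓ hQ ⟨v₀, hv₀, hv₀fix⟩ hmax n
  have hp : ℓ.Prime := Fact.out
  have hlog : ∀ n, ∃ t : ℕ → ℂ_[ℓ], SkewIwasawa.HasLogDeriv
      (SkewIwasawa.polyR Q F (ζ n) (S n) : PowerSeries ℂ_[ℓ]) t ∧
      ∀ j, ((ℓ ^ (n - n₀) : ℕ) : ℂ_[ℓ]) * t j =
        SkewIwasawa.traceSum Q F n (ζ n) (j * ℓ ^ (n - n₀)) := fun n =>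
    SkewIwasawa.hasLogDeriv_polyR Q F (ζ n) (hS n) (hk n) (pow_pos hp.pos _) fun v hv =>
      SkewIwasawa.pow_sub_dvd_orbitSize hℓ hQ hmax ((hS n).1 v hv)
  choose t hlog ht using hlog
  have hR : ∀ n, ∃ R : ℤ_[ℓ][X],
      R.map (SkewIwasawa.ofPadicInt ℓ) = SkewIwasawa.polyR Q F (ζ n) (S n) := by
    intro n
    refine SkewIwasawa.exists_map_eq_of_hasLogDeriv (hlog n) (fun j hj => ?_)
      (SkewIwasawa.coeff_polyR_mem_unitBall Q F (hζ n).pow_eq_one (S n))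
    obtain ⟨z, hz⟩ := SkewIwasawa.exists_traceSum_eq Q F (hζ n).pow_eq_one
      (Nat.mul_pos hj (pow_pos hp.pos (n - n₀)))
    have hne : ((ℓ ^ (n - n₀) : ℕ) : ℂ_[ℓ]) ≠ 0 := Nat.cast_ne_zero.2 (pow_pos hp.pos _).ne'
    refine ⟨(z : ℚ_[ℓ]) / (ℓ ^ (n - n₀) : ℕ), ?_⟩
    rw [map_div₀, map_natCast, div_eq_iff hne, mul_comm, ht, hz]
    rfl
  choose R hR using hR
  have hcong : ∀ n K, n₀ ≤ n → 0 < K →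
      (∀ j, 0 < j → ℓ ^ K ∣ Nat.card (SkewIwasawa.nonprimFixed Q (n + 1)
        ((ℓ * (j * ℓ ^ (n - n₀)) : ℕ) : ℤ))) →
      Polynomial.C ((ℓ : ℤ_[ℓ]) ^ K) ∣ R (n + 1) - R n ^ ℓ ^ (b - 1) := by
    intro n K hn hK hD
    have ht' := ht (n + 1)
    rw [Nat.sub_add_comm hn] at ht'
    exact SkewIwasawa.prime_pow_dvd_sub_of_traceSum hb hℓ hQ F (hn₀.trans_le hn) hK (hζ n)
      (hζ (n + 1)) hD ((hR n).symm ▸ hlog n) ((hR (n + 1)).symm ▸ hlog (n + 1)) (ht n) ht'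
  have hprim : ∀ n, SkewIwasawa.IsPrimitive (SkewIwasawa.red (n + 1) v₀) := fun n =>
    (SkewIwasawa.isPrimitive_red_iff n.succ_pos).2 hv₀
  have hfixed : ∀ n j, n₀ ≤ n →
      SkewIwasawa.act Q ((ℓ * (j * ℓ ^ (n - n₀)) : ℕ) : ℤ) (SkewIwasawa.red (n + 1) v₀) =
        SkewIwasawa.red (n + 1) v₀ := by
    intro n j hn
    rw [← SkewIwasawa.orbitSize_dvd_iff]
    refine ((SkewIwasawa.orbitSize_dvd_iff Q).2
      (SkewIwasawa.act_pow_sub_red hℓ hQ hv₀fix (n + 1))).trans ⟨j, ?_⟩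
    rw [Nat.sub_add_comm hn]
    ring
  refine ⟨R, hR, n₀, hk, fun n hn => hcong n n hn (hn₀.trans_le hn) fun j _ =>
    SkewIwasawa.pow_dvd_card_nonprimFixed Q (hn₀.trans_le hn) (hprim n) (hfixed n j hn), ?_⟩
  rintro ⟨q, hq⟩ n hn
  exact hcong n (n * b) hn (Nat.mul_pos (hn₀.trans_le hn) hb) fun j _ =>
    SkewIwasawa.pow_mul_dvd_card_nonprimFixed Q n
      (SkewIwasawa.act_eq_self_of_scalar hq _ (hprim n) (hfixed n j hn))
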